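/- Let $I\subset\mathbb{R}\setminus\{0\}$ be a finite set and, for $i\in I$, let $\lambda_i:[0,\infty)\to[0,\infty)$ be integrable on every bounded interval, with $\Lambda_i(t)=\int_0^t\lambda_i(s)\,ds<\infty$ for all $t\ge 0$. Let $S=(S(t))_{t\ge0}$ be a real stochastic process on a probability space $(\Omega,P)$ with $S(0)=0$ almost surely. Consider the following two descriptions of $S$. (i) $S$ has independent increments, is continuous in probability, and for every $t\ge0$ the infinitesimal relation $(\ast_t)$ holds: for every $n\in\mathbb{R}$ with $P\{S(t)=n\}>0$, as $h\to0^+$, $$P\{S(t+h)=n+j\mid S(t)=n\}=\begin{cases}\lambda_j(t)h+o(h), & j\in I,\\ 1-\sum_{i\in I}\lambda_i(t)h+o(h), & j=0,\\ o(h), & \text{for every other } j\in\mathbb{R}.\end{cases}$$ (ii) There are independent non-homogeneous Poisson processes $N_i$, $i\in I$, on $(\Omega,P)$, with rate functions $\lambda_i$, such that for every $t\ge0$, $S(t)=\sum_{i\in I}iN_i(t)$ almost surely. Here a Poisson process with rate function $\lambda$ is a process $N$ with values in $\{0,1,2,\dots\}$, $N(0)=0$ almost surely, almost surely nondecreasing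 right-continuous paths, independent increments, and $N(t)-N(s)$ Poisson distributed with mean $\int_s^t\lambda(x)\,dx$ for $s\le t$. Then: 1. If, for every $i\in I$ and $t\ge0$, $\Lambda_i$ has right derivative $\lambda_i(t)$ at $t$ (for instance if the $\lambda_i$ are right-continuous), then (i) and (ii) are equivalent. 2. For arbitrary locally integrable $\lambda_i$, (i) implies (ii). Conversely, for arbitrary locally integrable $\lambda_i$, (ii) implies that $S$ has independent increments, is continuous in probability, and satisfies $(\ast_t)$ at every $t\ge0$ at which each $\Lambda_i$ has right derivative $\lambda_i(t)$. 3. If the paths of $S$ are almost surely right-continuous, then (ii) is equivalent to its pathwise form: there are independent Poisson processes $N_i$ as in (ii) such that, almost surely, $S(t)=\sum_{i\in I}iN_i(t)$ for all $t\ge0$ simultaneously. 4. If (i) or (ii) holds, then for all $t\ge0$ and $u>0$ the variable $u^{S(t)}$ is integrable and $$\mathbb{E}\,u^{S(t)}=\exp\Bigl(-\sum_{i\in I}\Lambda_i(t)\,(1-u^i)\Bigr).$$ -/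

import Mathlib

open MeasureTheory ProbabilityTheory Filter Topology Asymptotics
open scoped NNReal ENNReal

namespace Skellam

/-- The cumulative rate `Λ(t) = ∫₀ᵗ r(s) ds`, for `t ≥ 0`, of a rate function `r`
(only the values of `r` on `[0, ∞)` matter). -/
noncomputable def cumRate (r : ℝ → ℝ) (t : ℝ) : ℝ := ∫ s in (0 : ℝ)..t, r s

/-- A stochastic process is continuous in probability: `S s → S t` in probability as `s → t`,
for every `t ≥ 0`. -/
def StochContinuous {Ω : Type*} {mΩ : MeasurableSpace Ω} (P : Measure Ω)
    (S : ℝ≥0 → Ω → ℝ) : Prop :=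
  ∀ t : ℝ≥0, TendstoInMeasure P S (𝓝 t) (S t)

/-- The transition probability `P{S(t + h) = n + j | S(t) = n}`. -/
noncomputable def transProb {Ω : Type*} {mΩ : MeasurableSpace Ω} (P : Measure Ω)
    (S : ℝ≥0 → Ω → ℝ) (t h : ℝ≥0) (n j : ℝ) : ℝ :=
  (ProbabilityTheory.cond P {ω | S t ω = n}).real {ω | S (t + h) ω = n + j}

/-- The infinitesimal jump behaviour at time `t`: for every `n` which `S(t)` takes with positive
probability, as `h → 0+`,
`P{S(t+h) = n + i | S(t) = n} = λ_i(t) h + o(h)` for `i ∈ I`,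
`P{S(t+h) = n | S(t) = n} = 1 - ∑_{i ∈ I} λ_i(t) h + o(h)`, and
`P{S(t+h) = n + j | S(t) = n} = o(h)` for all other real numbers `j`. -/
def InfinitesimalJumpsAt {Ω : Type*} {mΩ : MeasurableSpace Ω} (P : Measure Ω)
    (I : Finset ℝ) (lam : I → ℝ → ℝ) (S : ℝ≥0 → Ω → ℝ) (t : ℝ≥0) : Prop :=
  ∀ n : ℝ, P {ω | S t ω = n} ≠ 0 →
    (∀ i : I, (fun h : ℝ≥0 ↦ transProb P S t h n (i : ℝ) - lam i t * (h : ℝ))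
        =o[𝓝[>] 0] (fun h : ℝ≥0 ↦ (h : ℝ))) ∧
    ((fun h : ℝ≥0 ↦ transProb P S t h n 0 - (1 - ∑ i : I, lam i t * (h : ℝ)))
        =o[𝓝[>] 0] (fun h : ℝ≥0 ↦ (h : ℝ))) ∧
    (∀ j : ℝ, j ≠ 0 → j ∉ I →
      (fun h : ℝ≥0 ↦ transProb P S t h n j) =o[𝓝[>] 0] (fun h : ℝ≥0 ↦ (h : ℝ)))

/-- First description of the process: independent increments, continuity in probability, and
jumps of size `i ∈ I` at infinitesimal rate `λ_i(t)`, at every time `t ≥ 0`. -/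
structure IsInfinitesimalSkellam {Ω : Type*} {mΩ : MeasurableSpace Ω} (P : Measure Ω)
    (I : Finset ℝ) (lam : I → ℝ → ℝ) (S : ℝ≥0 → Ω → ℝ) : Prop where
  indep_increments : HasIndepIncrements S P
  stoch_continuous : StochContinuous P S
  jumps : ∀ t : ℝ≥0, InfinitesimalJumpsAt P I lam S t

/-- `N` is a (non-homogeneous) Poisson process with rate function `r`: a counting process started
at `0`, with almost surely nondecreasing right-continuous paths and independent increments, such
that `N(t) - N(s)` has the Poisson law of mean `∫ₛᵗ r` for `s ≤ t`. -/
structure IsPoissonProcess {Ω : Type*} {mΩ : MeasurableSpace Ω} (P : Measure Ω)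
    (r : ℝ → ℝ) (N : ℝ≥0 → Ω → ℕ) : Prop where
  measurable : ∀ t, Measurable (N t)
  zero : ∀ᵐ ω ∂P, N 0 ω = 0
  paths : ∀ᵐ ω ∂P, Monotone (fun t ↦ N t ω) ∧
    ∀ t : ℝ≥0, ContinuousWithinAt (fun s ↦ N s ω) (Set.Ici t) t
  indep_increments : HasIndepIncrements (fun t ω ↦ (N t ω : ℝ)) P
  law_increments : ∀ s t : ℝ≥0, s ≤ t →
    HasLaw (fun ω ↦ (N t ω : ℝ) - (N s ω : ℝ))
      ((poissonMeasure (Real.toNNReal (∫ x in (s : ℝ)..(t : ℝ), r x))).map (Nat.cast : ℕ → ℝ)) P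

/-- `N_i`, `i ∈ I`, are independent Poisson processes with rate functions `λ_i`; the independence
is that of the processes, as random elements of the space of all functions from `[0, ∞)` to `ℕ`
with the product `σ`-algebra. -/
structure IsIndepPoissonFamily {Ω : Type*} {mΩ : MeasurableSpace Ω} (P : Measure Ω)
    (I : Finset ℝ) (lam : I → ℝ → ℝ) (N : I → ℝ≥0 → Ω → ℕ) : Prop where
  poisson : ∀ i, IsPoissonProcess P (lam i) (N i)
  indep : iIndepFun (fun (i : I) (ω : Ω) (t : ℝ≥0) ↦ N i t ω) P

/-- Second description of the process: there are independent Poisson processes `N_i`, with rate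
functions `λ_i`, such that for every `t ≥ 0`, `S(t) = ∑_{i ∈ I} i N_i(t)` almost surely. -/
def IsPoissonCombination {Ω : Type*} {mΩ : MeasurableSpace Ω} (P : Measure Ω)
    (I : Finset ℝ) (lam : I → ℝ → ℝ) (S : ℝ≥0 → Ω → ℝ) : Prop :=
  ∃ N : I → ℝ≥0 → Ω → ℕ, IsIndepPoissonFamily P I lam N ∧
    ∀ t : ℝ≥0, ∀ᵐ ω ∂P, S t ω = ∑ i : I, (i : ℝ) * (N i t ω : ℝ)

/-- The pathwise form of the second description: almost surely, `S(t) = ∑_{i ∈ I} i N_i(t)` for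
all `t ≥ 0` simultaneously. -/
def IsPathwisePoissonCombination {Ω : Type*} {mΩ : MeasurableSpace Ω} (P : Measure Ω)
    (I : Finset ℝ) (lam : I → ℝ → ℝ) (S : ℝ≥0 → Ω → ℝ) : Prop :=
  ∃ N : I → ℝ≥0 → Ω → ℕ, IsIndepPoissonFamily P I lam N ∧
    ∀ᵐ ω ∂P, ∀ t : ℝ≥0, S t ω = ∑ i : I, (i : ℝ) * (N i t ω : ℝ)

/-- `r(t)` is the exact infinitesimal rate at time `t`: `∫ₜ^{t+h} r = r(t) h + o(h)` as `h → 0+`. -/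
def HasRateAt (r : ℝ → ℝ) (t : ℝ≥0) : Prop :=
  HasDerivWithinAt (cumRate r) (r t) (Set.Ici (t : ℝ)) (t : ℝ)

end Skellam

/-! From (i) to (ii). Write m = ∑ ∫ₛᵗ λ_i. Independence turns the conditional law in the
infinitesimal relation into the law of an increment, but only at times when S has an atom. Atoms
must therefore be propagated from time 0. Continuity in probability makes f(u) = P{S(u) = S(s)}
upper semicontinuous; while f > 0 an atom at time s survives, so the relation applies and f decays
at logarithmic rate at most ∑ λ_i. Real induction (`exp_neg_integral_le_of_upperSemicontinuous`)
then gives f(t) ≥ exp(-m), so the relation is available at every time and P{S(t) ≠ S(s)} ≤ m. For ψ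
bounded by 1, u ↦ E ψ(S(u) - S(s)) is continuous and has a right derivative everywhere; integrating
it yields E ψ(S(t) - S(s)) = ψ(0) + ∑ ∫ₛᵗ λ_i (ψ(i) - ψ(0)) + O(m²)
(`norm_integral_comp_increment_sub_le`).

Without path regularity the jumps cannot be read off the paths. Instead, the increments of size i
are counted on dyadic grids. Refining a grid changes a count only if both halves of some interval
move; the probabilities of this are bounded by a telescoping sequence, so by Borel–Cantelli the
counts stabilise at each dyadic time. The expansion and independence identify the joint
characteristic functions of the limits as those of independent Poisson processes. Right-continuous
regularization reaches all times, and continuity in probability carries the identity S = ∑ i N_i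
along (`exists_counting_processes`).

From (ii) to (i). The Poisson laws bound from below the probabilities that an increment of S is 0 or
i, by exp(-m) and exp(-m) ∫ₛᵗ λ_i. Since the total mass is 1, these bounds are sharp up to O(m²)
(`abs_real_increment_sub_le`), and m² is o(h) where the primitives of the rates have right
derivatives. The generating function is a product of Poisson ones. -/

namespace Skellam

/-! ### A differential inequality for upper semicontinuous functions -/

/-- A lower bound by real induction: an upper semicontinuous function on `[a, b]` whose logarithm
decreases to the right of each point at rate at most `φ` decreases at most by the factor
`exp (-∫ φ)`. -/
theorem exp_neg_integral_le_of_upperSemicontinuous {f φ : ℝ → ℝ} {a b : ℝ} (hab : a ≤ b)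
    (hf : UpperSemicontinuous f) (ha : f a = 1) (φint : IntegrableOn φ (Set.Icc a b))
    (hstep : ∀ t ∈ Set.Ico a b, 0 < f t → ∀ y > φ t,
      ∀ᶠ u in 𝓝[>] t, f t * Real.exp (-((u - t) * y)) ≤ f u) :
    Real.exp (-∫ x in a..b, φ x) ≤ f b := by
  -- Extension by zero gives an integrable function on the whole line, as the approximation below
  -- requires.
  set ψ : ℝ → ℝ := (Set.Icc a b).indicator φ with hψ
  have ψint : Integrable ψ := φint.integrable_indicator measurableSet_Icc
  have hψφ : ∫ x in a..b, φ x = ∫ x in a..b, ψ x := by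
    apply intervalIntegral.integral_congr
    intro x hx
    rw [Set.uIcc_of_le hab] at hx
    simp [hψ, hx]
  suffices H : ∀ ε > 0, Real.exp (-((∫ x in a..b, ψ x) + ε)) ≤ f b by
    rw [hψφ]
    have h1 : Tendsto (fun ε : ℝ ↦ Real.exp (-((∫ x in a..b, ψ x) + ε))) (𝓝[>] 0)
        (𝓝 (Real.exp (-((∫ x in a..b, ψ x) + 0)))) := by
      apply Tendsto.mono_left _ nhdsWithin_le_nhds
      apply Continuous.tendsto
      fun_prop
    rw [add_zero] at h1
    exact le_of_tendsto h1 (eventually_mem_nhdsWithin.mono fun ε hε ↦ H ε hε)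
  intro ε εpos
  -- Vitali–Carathéodory: a bound on φ at the single point `t` says nothing nearby, while a strict
  -- lower bound for a lower semicontinuous majorant persists near `t`, at the cost of ε in the
  -- integral.
  obtain ⟨G, ψ_lt_G, Gcont, Gint, Glt_top, hG⟩ :=
    exists_lt_lowerSemicontinuous_integral_lt ψ ψint εpos
  set g : ℝ → ℝ := fun x ↦ (G x).toReal with hg
  have hgG : ∀ᵐ x : ℝ, ψ x ≤ g x := by
    filter_upwards [Glt_top] with x hx
    apply EReal.coe_le_coe_iff.1
    rw [hg, EReal.coe_toReal hx.ne (ψ_lt_G x).ne_bot]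
    exact (ψ_lt_G x).le
  set s := {t | Real.exp (-∫ u in a..t, g u) ≤ f t} ∩ Set.Icc a b
  have hcont : Continuous fun t ↦ ∫ u in a..t, g u :=
    intervalIntegral.continuous_primitive (fun _ _ ↦ Gint.intervalIntegrable) a
  have s_closed : IsClosed s := by
    refine IsClosed.inter ?_ isClosed_Icc
    have : UpperSemicontinuous fun t ↦ f t + -Real.exp (-∫ u in a..t, g u) :=
      hf.add (Continuous.upperSemicontinuous (by fun_prop))
    convert! this.isClosed_preimage 0 using 1
    ext t
    simp
  have main : Set.Icc a b ⊆ {t | Real.exp (-∫ u in a..t, g u) ≤ f t} := by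
    refine s_closed.Icc_subset_of_forall_exists_gt (by simp [ha]) fun t ht v t_lt_v ↦ ?_
    -- The rate `y` separates φ(t) from G(t): y > φ(t) activates `hstep`, and y < G near `t` gives
    -- (u - t) y ≤ ∫ g. Together they extend the inequality to the right of `t`.
    obtain ⟨y, hy1, hy2⟩ := EReal.lt_iff_exists_real_btwn.1 (ψ_lt_G t)
    have hy1' : φ t < y := by
      have := EReal.coe_lt_coe_iff.1 hy1
      rwa [hψ, Set.indicator_of_mem (show t ∈ Set.Icc a b from ⟨ht.2.1, ht.2.2.le⟩)] at this
    have I1 : ∀ᶠ u in 𝓝[>] t, (u - t) * y ≤ ∫ w in t..u, g w := by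
      have B : ∀ᶠ u in 𝓝 t, (y : EReal) < G u := Gcont.lowerSemicontinuousAt _ _ hy2
      rcases mem_nhds_iff_exists_Ioo_subset.1 B with ⟨m, M, ⟨hm, hM⟩, H⟩
      filter_upwards [Ioo_mem_nhdsGT hM] with u hu
      calc
        (u - t) * y = ∫ _ in t..u, y := by simp
        _ ≤ ∫ w in t..u, g w := by
          apply intervalIntegral.integral_mono_ae_restrict hu.1.le (by simp)
            Gint.intervalIntegrable
          filter_upwards [ae_mono Measure.restrict_le_self Glt_top,
            ae_restrict_mem measurableSet_Icc] with x G'x hx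
          apply EReal.coe_le_coe_iff.1
          have : x ∈ Set.Ioo m M := ⟨hm.trans_le hx.1, hx.2.trans_lt hu.2⟩
          refine (H this).out.le.trans_eq ?_
          exact (EReal.coe_toReal G'x.ne (ψ_lt_G x).ne_bot).symm
    have hft : 0 < f t := (Real.exp_pos _).trans_le ht.1
    have I4 : ∀ᶠ u in 𝓝[>] t, u ∈ Set.Ioc t (min v b) :=
      Ioc_mem_nhdsGT <| lt_min t_lt_v ht.2.2
    obtain ⟨x, ⟨hx1, hx2⟩, h'x⟩ := ((I1.and (hstep t ht.2 hft y hy1')).and I4).exists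
    refine ⟨x, ?_, Set.Ioc_subset_Ioc le_rfl (min_le_left _ _) h'x⟩
    calc
      Real.exp (-∫ u in a..x, g u)
        = Real.exp (-∫ u in a..t, g u) * Real.exp (-∫ u in t..x, g u) := by
        rw [← Real.exp_add, ← intervalIntegral.integral_add_adjacent_intervals
          (Gint.intervalIntegrable (a := a) (b := t)) Gint.intervalIntegrable]
        ring_nf
      _ ≤ f t * Real.exp (-((x - t) * y)) := by
        have := ht.1.out
        gcongr
      _ ≤ f x := hx2
  refine le_trans ?_ (main (Set.right_mem_Icc.2 hab))
  rw [Real.exp_le_exp]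
  have h1 : ∫ x in a..b, (g x - ψ x) ≤ ∫ x, (g x - ψ x) := by
    rw [intervalIntegral.integral_of_le hab]
    exact setIntegral_le_integral (Gint.sub ψint)
      (by filter_upwards [hgG] with x hx using sub_nonneg.2 hx)
  rw [integral_sub Gint ψint, intervalIntegral.integral_sub Gint.intervalIntegrable
    ψint.intervalIntegrable] at h1
  linarith

/-! ### Atoms and the probability of not moving -/

section Increments

variable {Ω : Type*} {mΩ : MeasurableSpace Ω} {P : Measure Ω}
  {I : Finset ℝ} {lam : I → ℝ → ℝ} {S : ℝ≥0 → Ω → ℝ}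

/-- The probability `P{S(t + h) - S(t) = j}`. -/
noncomputable def incProb (P : Measure Ω) (S : ℝ≥0 → Ω → ℝ) (t h : ℝ≥0) (j : ℝ) : ℝ :=
  P.real {ω | S (t + h) ω - S t ω = j}

/-- As S(0) = 0 almost surely, S(s) is itself an increment, independent of the next one. -/
lemma real_eval_inter_increment (S_zero : ∀ᵐ ω ∂P, S 0 ω = 0)
    (hS : HasIndepIncrements S P) {s t : ℝ≥0} (hst : s ≤ t)
    (n j : ℝ) :
    P.real {ω | S s ω = n ∧ S t ω - S s ω = j} =
      P.real {ω | S s ω = n} * P.real {ω | S t ω - S s ω = j} := by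
  have h := (hS.indepFun_eval_sub zero_le hst S_zero).measure_inter_preimage_eq_mul
    {n} {j} (measurableSet_singleton n) (measurableSet_singleton j)
  have := congrArg ENNReal.toReal h
  rwa [ENNReal.toReal_mul] at this

/-- Dividing the product formula by P{S(t) = n} removes the conditioning. The result does not depend
on n, so a single atom at time t is enough to exploit the relation there. -/
lemma transProb_eq_incProb [IsProbabilityMeasure P] (S_measurable : ∀ t, Measurable (S t))
    (S_zero : ∀ᵐ ω ∂P, S 0 ω = 0) (hS : HasIndepIncrements S P) {t : ℝ≥0} {n : ℝ}
    (hn : P {ω | S t ω = n} ≠ 0) (h : ℝ≥0) (j : ℝ) :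
    transProb P S t h n j = incProb P S t h j := by
  have hm : MeasurableSet {ω | S t ω = n} := S_measurable t (measurableSet_singleton n)
  have hset : {ω | S t ω = n} ∩ {ω | S (t + h) ω = n + j} =
      {ω | S t ω = n ∧ S (t + h) ω - S t ω = j} := by
    ext ω
    simp only [Set.mem_inter_iff, Set.mem_ofPred_eq, and_congr_right_iff]
    rintro rfl
    constructor <;> intro h <;> linarith
  have hn' : P.real {ω | S t ω = n} ≠ 0 := by
    rw [Measure.real, ENNReal.toReal_ne_zero]
    exact ⟨hn, measure_ne_top _ _⟩
  rw [transProb, incProb, Measure.real, cond_apply hm, hset, ENNReal.toReal_mul,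
    ENNReal.toReal_inv]
  have := real_eval_inter_increment S_zero hS (le_self_add : t ≤ t + h) n j
  simp only [Measure.real] at this hn' ⊢
  rw [this]
  field_simp

/-- The probability that a process continuous in probability has not moved since time `s` is
upper semicontinuous. -/
lemma upperSemicontinuous_real_eq [IsProbabilityMeasure P] (S_measurable : ∀ t, Measurable (S t))
    (hS : StochContinuous P S) (s : ℝ≥0) :
    UpperSemicontinuous fun t : ℝ≥0 ↦ P.real {ω | S t ω = S s ω} := by
  intro t y hy
  -- The event S(t) = S(s) is a decreasing intersection of closeness events, so some fixed k already
  -- has probability below `y`; the remaining gap absorbs the distance from S(u) to S(t).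
  have hlim : Tendsto (fun k : ℕ ↦ P.real {ω | |S t ω - S s ω| ≤ 1 / ((k : ℝ) + 1)}) atTop
      (𝓝 (P.real {ω | S t ω = S s ω})) := by
    have hset : {ω | S t ω = S s ω} = ⋂ k : ℕ, {ω | |S t ω - S s ω| ≤ 1 / ((k : ℝ) + 1)} := by
      ext ω
      simp only [Set.mem_ofPred_eq, Set.mem_iInter]
      constructor
      · intro h k
        rw [h, sub_self, abs_zero]
        positivity
      · intro h
        have := ge_of_tendsto' tendsto_one_div_add_atTop_nhds_zero_nat h
        exact sub_eq_zero.1 (abs_nonpos_iff.1 this)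
    rw [hset]
    apply (ENNReal.tendsto_toReal (measure_ne_top _ _)).comp
    apply tendsto_measure_iInter_atTop
    · intro k
      exact (measurableSet_le (by fun_prop) measurable_const).nullMeasurableSet
    · intro k l hkl ω hω
      exact hω.out.trans (one_div_le_one_div_of_le (by positivity) (by gcongr))
    · exact ⟨0, measure_ne_top _ _⟩
  obtain ⟨k, hk⟩ := (hlim.eventually (gt_mem_nhds hy)).exists
  have hk0 : (0 : ℝ) < 1 / ((k : ℝ) + 1) := by positivity
  have h1 := (tendstoInMeasure_iff_measureReal_dist.1 (hS t)) _ hk0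
  have h2 := h1.eventually (gt_mem_nhds (sub_pos.2 hk))
  filter_upwards [h2] with u hu
  have : P.real {ω | S u ω = S s ω} ≤ P.real {ω | |S t ω - S s ω| ≤ 1 / ((k : ℝ) + 1)} +
      P.real {ω | 1 / ((k : ℝ) + 1) ≤ dist (S u ω) (S t ω)} := by
    refine (measureReal_mono ?_).trans (measureReal_union_le _ _)
    intro ω (hω : S u ω = S s ω)
    rcases le_total |S t ω - S s ω| (1 / ((k : ℝ) + 1)) with h | h
    · exact Or.inl h
    · refine Or.inr ?_
      simpa [Real.dist_eq, hω, abs_sub_comm] using h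
  linarith

/-- The expected number `∑ i, ∫ₛᵗ λ_i` of jumps between the times `s` and `t`. -/
noncomputable def jumpMean (lam : I → ℝ → ℝ) (s t : ℝ) : ℝ := ∑ i : I, ∫ x in s..t, lam i x

lemma intervalIntegrable_rate
    (lam_integrable : ∀ (i : I) (t : ℝ), 0 ≤ t → IntegrableOn (lam i) (Set.Icc 0 t) volume)
    (i : I) {s t : ℝ} (hs : 0 ≤ s) (ht : 0 ≤ t) : IntervalIntegrable (lam i) volume s t := by
  rw [intervalIntegrable_iff]
  refine (lam_integrable i (max s t) (by positivity)).mono_set ?_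
  intro x hx
  exact ⟨(le_min hs ht).trans hx.1.le, hx.2⟩

lemma integral_rate_nonneg (lam_nonneg : ∀ (i : I) (t : ℝ), 0 ≤ t → 0 ≤ lam i t)
    (i : I) {s t : ℝ} (hs : 0 ≤ s) (hst : s ≤ t) : 0 ≤ ∫ x in s..t, lam i x :=
  intervalIntegral.integral_nonneg hst fun x hx ↦ lam_nonneg i x (hs.trans hx.1)

lemma jumpMean_nonneg (lam_nonneg : ∀ (i : I) (t : ℝ), 0 ≤ t → 0 ≤ lam i t)
    {s t : ℝ} (hs : 0 ≤ s) (hst : s ≤ t) : 0 ≤ jumpMean lam s t :=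
  Finset.sum_nonneg fun i _ ↦ integral_rate_nonneg lam_nonneg i hs hst

lemma jumpMean_add
    (lam_integrable : ∀ (i : I) (t : ℝ), 0 ≤ t → IntegrableOn (lam i) (Set.Icc 0 t) volume)
    {r s t : ℝ} (hr : 0 ≤ r) (hs : 0 ≤ s) (ht : 0 ≤ t) :
    jumpMean lam r s + jumpMean lam s t = jumpMean lam r t := by
  rw [jumpMean, jumpMean, jumpMean, ← Finset.sum_add_distrib]
  exact Finset.sum_congr rfl fun i _ ↦ intervalIntegral.integral_add_adjacent_intervals
    (intervalIntegrable_rate lam_integrable i hr hs)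
    (intervalIntegrable_rate lam_integrable i hs ht)

lemma jumpMean_eq_integral
    (lam_integrable : ∀ (i : I) (t : ℝ), 0 ≤ t → IntegrableOn (lam i) (Set.Icc 0 t) volume)
    {s t : ℝ} (hs : 0 ≤ s) (ht : 0 ≤ t) : jumpMean lam s t = ∫ x in s..t, ∑ i : I, lam i x := by
  rw [intervalIntegral.integral_finsetSum fun i _ ↦
    intervalIntegrable_rate lam_integrable i hs ht, jumpMean]

lemma jumpMean_mono (lam_nonneg : ∀ (i : I) (t : ℝ), 0 ≤ t → 0 ≤ lam i t)
    (lam_integrable : ∀ (i : I) (t : ℝ), 0 ≤ t → IntegrableOn (lam i) (Set.Icc 0 t) volume)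
    {r s t u : ℝ} (hr : 0 ≤ r) (hrs : r ≤ s) (hst : s ≤ t) (htu : t ≤ u) :
    jumpMean lam s t ≤ jumpMean lam r u := by
  have h1 := jumpMean_add lam_integrable hr (hr.trans hrs) ((hr.trans hrs).trans hst)
  have h2 := jumpMean_add lam_integrable hr ((hr.trans hrs).trans hst)
    (((hr.trans hrs).trans hst).trans htu)
  have h3 := jumpMean_nonneg lam_nonneg hr hrs
  have h4 := jumpMean_nonneg lam_nonneg ((hr.trans hrs).trans hst) htu
  linarith

lemma tendsto_sub_toNNReal (t : ℝ) :
    Tendsto (fun u : ℝ ↦ (u - t).toNNReal) (𝓝[>] t) (𝓝[>] 0) := by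
  apply tendsto_nhdsWithin_of_tendsto_nhds_of_eventually_within
  · have : Tendsto (fun u : ℝ ↦ (u - t).toNNReal) (𝓝 t) (𝓝 (t - t).toNNReal) :=
      (by fun_prop : Continuous fun u : ℝ ↦ (u - t).toNNReal).tendsto t
    simpa using this.mono_left nhdsWithin_le_nhds
  · filter_upwards [self_mem_nhdsWithin] with u hu
    simpa using hu

lemma eventually_increment_nonzero_prob_le (t : ℝ≥0)
    (h0 : (fun h : ℝ≥0 ↦ incProb P S t h 0 - (1 - ∑ i : I, lam i t * (h : ℝ)))
        =o[𝓝[>] 0] (fun h : ℝ≥0 ↦ (h : ℝ))) {y : ℝ} (hy : ∑ i : I, lam i t < y) :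
    ∀ᶠ h : ℝ≥0 in 𝓝[>] 0, Real.exp (-((h : ℝ) * y)) ≤ incProb P S t h 0 := by
  set r := ∑ i : I, lam i t with hr
  have hexp : (fun h : ℝ≥0 ↦ Real.exp (-((h : ℝ) * y)) - (1 - (h : ℝ) * y)) =o[𝓝[>] 0]
      (fun h : ℝ≥0 ↦ (h : ℝ)) := by
    have hd : HasDerivAt (fun x : ℝ ↦ Real.exp (-(x * y))) (-y) 0 := by
      have := (((hasDerivAt_id (0 : ℝ)).mul_const y).neg).exp
      simpa using this
    have hto : Tendsto (fun h : ℝ≥0 ↦ (h : ℝ)) (𝓝[>] 0) (𝓝 0) := by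
      have : Tendsto (fun h : ℝ≥0 ↦ (h : ℝ)) (𝓝 0) (𝓝 ((0 : ℝ≥0) : ℝ)) :=
        NNReal.continuous_coe.tendsto 0
      exact this.mono_left nhdsWithin_le_nhds
    have := (hasDerivAt_iff_isLittleO_nhds_zero.1 hd).comp_tendsto hto
    refine this.congr_left fun h ↦ ?_
    simp
    ring
  -- Half of the gap y - r absorbs each of the two o(h) errors.
  have hc : 0 < (y - r) / 2 := by linarith
  filter_upwards [(h0.def hc), (hexp.def hc)] with h h1 h2
  rw [← Finset.sum_mul, ← hr] at h1
  rw [Real.norm_eq_abs, Real.norm_of_nonneg h.coe_nonneg] at h1 h2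
  have h3 := (abs_le.1 h1).1
  have h4 := (abs_le.1 h2).2
  linarith

/-- From a time at which `S` has an atom, `S` does not move until time `t` with probability at
least `exp (-∑ i, ∫ₛᵗ λ_i)`. -/
lemma exp_neg_jumpMean_le_of_atom [IsProbabilityMeasure P]
    (lam_integrable : ∀ (i : I) (t : ℝ), 0 ≤ t → IntegrableOn (lam i) (Set.Icc 0 t) volume)
    (S_measurable : ∀ t, Measurable (S t)) (S_zero : ∀ᵐ ω ∂P, S 0 ω = 0)
    (hS : IsInfinitesimalSkellam P I lam S) {s t : ℝ≥0} (hst : s ≤ t) {n : ℝ}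
    (hn : P {ω | S s ω = n} ≠ 0) :
    Real.exp (-jumpMean lam s t) ≤ P.real {ω | S t ω = S s ω} := by
  have husc : UpperSemicontinuous fun u : ℝ ↦ P.real {ω | S u.toNNReal ω = S s ω} :=
    (upperSemicontinuous_real_eq S_measurable hS.stoch_continuous s).comp continuous_real_toNNReal
  rw [jumpMean_eq_integral lam_integrable s.coe_nonneg t.coe_nonneg]
  have key := exp_neg_integral_le_of_upperSemicontinuous (φ := fun x ↦ ∑ i : I, lam i x)
    (NNReal.coe_le_coe.2 hst) husc (by simp) ?_ ?_
  · simpa using key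
  · refine integrable_finsetSum _ fun i _ ↦ (lam_integrable i t t.2).mono_set ?_
    exact Set.Icc_subset_Icc_left s.2
  · intro u hu hfu y hy
    have hu0 : 0 ≤ u := s.2.trans hu.1
    lift u to ℝ≥0 using hu0
    have hsu : s ≤ u := hu.1
    rw [Real.toNNReal_coe] at hfu
    -- The atom survives while f(u) > 0, since P{S(u) = n} ≥ P{S(s) = n} f(u) by independence. The
    -- relation at time `u` can therefore be used.
    have hnu : P {ω | S u ω = n} ≠ 0 := by
      have h1 := real_eval_inter_increment S_zero hS.indep_increments hsu n 0
      have h2 : 0 < P.real {ω | S s ω = n} := by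
        rw [Measure.real, ENNReal.toReal_pos_iff]
        exact ⟨pos_iff_ne_zero.2 hn, measure_lt_top _ _⟩
      have h3 : P {ω | S s ω = n ∧ S u ω - S s ω = 0} ≠ 0 := by
        simp only [sub_eq_zero] at h1 ⊢
        rw [Measure.real] at h1
        intro h0
        rw [h0] at h1
        have := mul_pos h2 hfu
        simp at h1
        rcases h1 with h1 | h1 <;> simp [h1] at h2 hfu
      intro h0
      refine h3 (measure_mono_null ?_ h0)
      rintro ω ⟨h1, h2⟩
      simp only [Set.mem_ofPred_eq]
      linarith
    have hj := (hS.jumps u n hnu).2.1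
    simp only [transProb_eq_incProb S_measurable S_zero hS.indep_increments hnu] at hj
    have hev := (tendsto_sub_toNNReal u).eventually
      (eventually_increment_nonzero_prob_le u hj hy)
    filter_upwards [hev, self_mem_nhdsWithin] with v hv huv
    have huv' : (u : ℝ) < v := huv
    rw [Real.coe_toNNReal _ (by linarith)] at hv
    rw [Real.toNNReal_coe]
    have hadd : u + (v - u).toNNReal = v.toNNReal := by
      ext
      simp [huv'.le, u.2.trans huv'.le]
    have hind := (hS.indep_increments.indepFun_sub_sub hsu
      (le_self_add : u ≤ u + (v - u).toNNReal)).measure_inter_preimage_eq_mul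
      {0} {0} (measurableSet_singleton _) (measurableSet_singleton _)
    have hind' := congrArg ENNReal.toReal hind
    rw [ENNReal.toReal_mul, hadd] at hind'
    -- Not having moved from s to u and from u to v are independent events, and together they force
    -- S(v) = S(s).
    have h5 : P.real {ω | S u ω = S s ω} * incProb P S u (v - u).toNNReal 0 ≤
        P.real {ω | S v.toNNReal ω = S s ω} := by
      rw [incProb, hadd]
      have e1 : {ω | S u ω = S s ω} = (S u - S s) ⁻¹' {0} := by
        ext ω; simp [sub_eq_zero]
      have e2 : {ω | S v.toNNReal ω - S u ω = 0} = (S v.toNNReal - S u) ⁻¹' {0} := by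
        ext ω; simp
      rw [e1, e2, Measure.real, Measure.real, ← hind']
      refine measureReal_mono ?_
      rintro ω ⟨h1, h2⟩
      simp only [Set.mem_preimage, Pi.sub_apply, Set.mem_singleton_iff] at h1 h2
      simp only [Set.mem_ofPred_eq]
      linarith
    exact (mul_le_mul_of_nonneg_left hv measureReal_nonneg).trans h5

/-- `S` has an atom at every time. -/
lemma measure_eq_zero_ne_zero [IsProbabilityMeasure P]
    (lam_integrable : ∀ (i : I) (t : ℝ), 0 ≤ t → IntegrableOn (lam i) (Set.Icc 0 t) volume)
    (S_measurable : ∀ t, Measurable (S t)) (S_zero : ∀ᵐ ω ∂P, S 0 ω = 0)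
    (hS : IsInfinitesimalSkellam P I lam S) (t : ℝ≥0) : P {ω | S t ω = 0} ≠ 0 := by
  have h0 : P {ω | S 0 ω = 0} = 1 :=
    (prob_compl_eq_zero_iff (S_measurable 0 (measurableSet_singleton 0))).1 S_zero
  have h1 := exp_neg_jumpMean_le_of_atom lam_integrable S_measurable S_zero hS
    (zero_le : 0 ≤ t) (n := 0) (by simp [h0])
  have h2 : P {ω | S t ω = S 0 ω} = P {ω | S t ω = 0} := by
    apply measure_congr
    filter_upwards [S_zero] with ω hω
    change (S t ω = S 0 ω) = (S t ω = 0)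
    rw [hω]
  intro h3
  rw [Measure.real, h2, h3] at h1
  exact absurd h1 (not_le.2 (by simpa using Real.exp_pos _))

/-- The atom at 0 is present at every time s, so the previous bound applies, and 1 - exp(-m) ≤ m. -/
lemma real_ne_le_jumpMean [IsProbabilityMeasure P]
    (lam_integrable : ∀ (i : I) (t : ℝ), 0 ≤ t → IntegrableOn (lam i) (Set.Icc 0 t) volume)
    (S_measurable : ∀ t, Measurable (S t)) (S_zero : ∀ᵐ ω ∂P, S 0 ω = 0)
    (hS : IsInfinitesimalSkellam P I lam S) {s t : ℝ≥0} (hst : s ≤ t) :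
    P.real {ω | S t ω ≠ S s ω} ≤ jumpMean lam s t := by
  have h1 := exp_neg_jumpMean_le_of_atom lam_integrable S_measurable S_zero hS hst
    (measure_eq_zero_ne_zero lam_integrable S_measurable S_zero hS s)
  have h2 : P.real {ω | S t ω ≠ S s ω} = 1 - P.real {ω | S t ω = S s ω} :=
    probReal_compl_eq_one_sub (measurableSet_eq_fun (S_measurable t) (S_measurable s))
  have h3 := Real.add_one_le_exp (-jumpMean lam s t)
  linarith

end Increments

/-! ### First-order estimates for expectations of bounded functions -/

section Estimates

variable {Ω : Type*} {mΩ : MeasurableSpace Ω} {P : Measure Ω}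
  {I : Finset ℝ} {lam : I → ℝ → ℝ} {S : ℝ≥0 → Ω → ℝ}

lemma integrable_comp_of_norm_le [IsProbabilityMeasure P] {X : Ω → ℝ} (hX : Measurable X)
    {φ : ℝ → ℂ} (hφ : Measurable φ) {C : ℝ} (hC : ∀ x, ‖φ x‖ ≤ C) :
    Integrable (fun ω ↦ φ (X ω)) P :=
  Integrable.of_bound (hφ.comp hX).aestronglyMeasurable C (ae_of_all _ fun _ ↦ hC _)

lemma integral_ite_eq {Y : Ω → ℝ} (hY : Measurable Y) (a : ℝ) :
    ∫ ω, (if Y ω = a then (1 : ℝ) else 0) ∂P = P.real {ω | Y ω = a} := by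
  have hm : MeasurableSet {ω | Y ω = a} := hY (measurableSet_singleton a)
  rw [← integral_indicator_one hm]
  congr 1 with ω

lemma integrable_ite_eq [IsProbabilityMeasure P] {Y : Ω → ℝ} (hY : Measurable Y) (a : ℝ) :
    Integrable (fun ω ↦ if Y ω = a then (1 : ℝ) else 0) P := by
  refine Integrable.of_bound (Measurable.aestronglyMeasurable ?_) 1 (ae_of_all _ fun ω ↦ ?_)
  · exact Measurable.ite (hY (measurableSet_singleton a)) measurable_const measurable_const
  · split_ifs <;> simp

/-- First-order expansion of `E ψ(X + Y)` when the independent increment `Y` is unlikely to lie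
outside `I ∪ {0}`. -/
lemma norm_integral_add_sub_le [IsProbabilityMeasure P] (hI : (0 : ℝ) ∉ I)
    {X Y : Ω → ℝ} (hX : Measurable X)
    (hY : Measurable Y) (hXY : IndepFun X Y P) {ψ : ℝ → ℂ} (hψ : Measurable ψ)
    (hψ1 : ∀ x, ‖ψ x‖ ≤ 1) :
    ‖∫ ω, ψ (X ω + Y ω) ∂P - ∫ ω, ψ (X ω) ∂P -
      ∑ i : I, (P.real {ω | Y ω = i} : ℂ) * ∫ ω, (ψ (X ω + i) - ψ (X ω)) ∂P‖ ≤
    2 * (1 - P.real {ω | Y ω = 0} - ∑ i : I, P.real {ω | Y ω = i}) := by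
  have hi1 : Integrable (fun ω ↦ ψ (X ω + Y ω)) P :=
    integrable_comp_of_norm_le (hX.add hY) hψ hψ1
  have hi2 : Integrable (fun ω ↦ ψ (X ω)) P := integrable_comp_of_norm_le hX hψ hψ1
  have hi3 (i : I) : Integrable (fun ω ↦ ψ (X ω + i) - ψ (X ω)) P :=
    (integrable_comp_of_norm_le (hX.add_const _) hψ hψ1).sub hi2
  have hprod (i : I) : Integrable (fun ω ↦ ((if Y ω = i then (1 : ℝ) else 0 : ℝ) : ℂ) *
      (ψ (X ω + i) - ψ (X ω))) P := by
    refine (hi3 i).bdd_mul (c := 1) (integrable_ite_eq hY i).ofReal.aestronglyMeasurable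
      (ae_of_all _ fun ω ↦ ?_)
    split_ifs <;> simp
  have hmul (i : I) : ∫ ω, ((if Y ω = i then (1 : ℝ) else 0 : ℝ) : ℂ) *
      (ψ (X ω + i) - ψ (X ω)) ∂P =
      (P.real {ω | Y ω = i} : ℂ) * ∫ ω, (ψ (X ω + i) - ψ (X ω)) ∂P := by
    rw [← integral_ite_eq hY, ← integral_complex_ofReal]
    have hm : Measurable fun y : ℝ ↦ ((if y = i then (1 : ℝ) else 0 : ℝ) : ℂ) :=
      Complex.measurable_ofReal.comp
        (Measurable.ite (measurableSet_singleton _) measurable_const measurable_const)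
    have hm' : Measurable fun x : ℝ ↦ ψ (x + i) - ψ x := by fun_prop
    exact (hXY.symm.comp hm hm').integral_fun_mul_eq_mul_integral
      (hm.comp hY).aestronglyMeasurable (hm'.comp hX).aestronglyMeasurable
  have hi12 : Integrable (fun ω ↦ ψ (X ω + Y ω) - ψ (X ω)) P := hi1.sub hi2
  have hj1 : Integrable (fun ω ↦ 1 - (if Y ω = 0 then (1 : ℝ) else 0)) P :=
    (integrable_const _).sub (integrable_ite_eq hY 0)
  have hite (i : I) : Integrable (fun ω ↦ if Y ω = i then (1 : ℝ) else 0) P :=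
    integrable_ite_eq hY i
  have hj2 : Integrable (fun ω ↦ ∑ i : I, if Y ω = i then (1 : ℝ) else 0) P :=
    integrable_finsetSum _ fun i _ ↦ hite i
  have hj3 : Integrable (fun ω ↦ 1 - (if Y ω = 0 then (1 : ℝ) else 0) -
      ∑ i : I, if Y ω = i then (1 : ℝ) else 0) P := hj1.sub hj2
  have hLHS : ∫ ω, ψ (X ω + Y ω) ∂P - ∫ ω, ψ (X ω) ∂P -
      ∑ i : I, (P.real {ω | Y ω = i} : ℂ) * ∫ ω, (ψ (X ω + i) - ψ (X ω)) ∂P =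
      ∫ ω, (ψ (X ω + Y ω) - ψ (X ω) - ∑ i : I, ((if Y ω = i then (1 : ℝ) else 0 : ℝ) : ℂ) *
        (ψ (X ω + i) - ψ (X ω))) ∂P := by
    rw [integral_sub hi12 (integrable_finsetSum _ fun i _ ↦ hprod i),
      integral_sub hi1 hi2, integral_finsetSum _ fun i _ ↦ hprod i]
    simp_rw [hmul]
  have hRHS : 2 * (1 - P.real {ω | Y ω = 0} - ∑ i : I, P.real {ω | Y ω = i}) =
      ∫ ω, 2 * (1 - (if Y ω = 0 then (1 : ℝ) else 0) -
        ∑ i : I, if Y ω = i then (1 : ℝ) else 0) ∂P := by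
    rw [integral_const_mul, integral_sub hj1 hj2,
      integral_sub (integrable_const _) (integrable_ite_eq hY 0),
      integral_finsetSum _ fun i _ ↦ hite i]
    simp_rw [integral_ite_eq hY]
    simp
  rw [hLHS, hRHS]
  refine norm_integral_le_of_norm_le ?_ (ae_of_all _ fun ω ↦ ?_)
  · exact hj3.const_mul 2
  -- The integrand vanishes if Y = 0, and also if Y ∈ I, where exactly one term of the sum survives
  -- and cancels the difference. Elsewhere it is at most 2.
  · by_cases hmem : Y ω ∈ I
    · have hne : Y ω ≠ 0 := fun h ↦ hI (h ▸ hmem)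
      have hiff (i : I) : (Y ω = i) ↔ (⟨Y ω, hmem⟩ : I) = i := by
        rw [Subtype.ext_iff]
      simp [hiff, hne, apply_ite Complex.ofReal, ite_mul]
    · have hne (i : I) : Y ω ≠ i := fun h ↦ hmem (h ▸ i.2)
      by_cases h0 : Y ω = 0
      · have hne' (i : I) : (0 : ℝ) ≠ i := h0 ▸ hne i
        simp [h0, hne']
      · simp only [hne, h0, if_false]
        simp only [Complex.ofReal_zero, zero_mul, Finset.sum_const_zero, sub_zero, mul_one]
        calc _ ≤ ‖ψ (X ω + Y ω)‖ + ‖ψ (X ω)‖ := norm_sub_le _ _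
          _ ≤ 2 := by linarith [hψ1 (X ω + Y ω), hψ1 (X ω)]

lemma norm_integral_comp_sub_le [IsProbabilityMeasure P] {X Y : Ω → ℝ}
    (hX : Measurable X) (hY : Measurable Y)
    {φ : ℝ → ℂ} (hφ : Measurable φ) {C : ℝ} (hC : ∀ x, ‖φ x‖ ≤ C) :
    ‖∫ ω, φ (X ω) ∂P - ∫ ω, φ (Y ω) ∂P‖ ≤ 2 * C * P.real {ω | X ω ≠ Y ω} := by
  have hm : MeasurableSet {ω | X ω ≠ Y ω} := (measurableSet_eq_fun hX hY).compl
  rw [← integral_sub (integrable_comp_of_norm_le hX hφ hC) (integrable_comp_of_norm_le hY hφ hC),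
    ← integral_indicator_one hm, ← integral_const_mul]
  refine norm_integral_le_of_norm_le ?_ (ae_of_all _ fun ω ↦ ?_)
  · exact ((integrable_const 1).indicator hm).const_mul _
  · by_cases h : X ω = Y ω
    · simp [h]
    · simp only [ne_eq, Set.indicator_apply, Set.mem_ofPred_eq, h, not_false_eq_true, if_true,
        Pi.one_apply, mul_one]
      calc _ ≤ ‖φ (X ω)‖ + ‖φ (Y ω)‖ := norm_sub_le _ _
        _ ≤ 2 * C := by linarith [hC (X ω), hC (Y ω)]

lemma continuousOn_jumpMean
    (lam_integrable : ∀ (i : I) (t : ℝ), 0 ≤ t → IntegrableOn (lam i) (Set.Icc 0 t) volume)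
    {T : ℝ} (hT : 0 ≤ T) : ContinuousOn (jumpMean lam 0) (Set.Icc 0 T) := by
  unfold jumpMean
  refine continuousOn_finsetSum _ fun i _ ↦ ?_
  rw [← Set.uIcc_of_le hT]
  exact intervalIntegral.continuousOn_primitive_interval
    (by rw [Set.uIcc_of_le hT]; exact lam_integrable i T hT)

/-- Passing from u to v costs at most 2C P{S(v) ≠ S(u)}, so the modulus of continuity is inherited
from the primitive `jumpMean lam 0`. -/
lemma continuousOn_integral_comp_increment [IsProbabilityMeasure P]
    (lam_integrable : ∀ (i : I) (t : ℝ), 0 ≤ t → IntegrableOn (lam i) (Set.Icc 0 t) volume)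
    (S_measurable : ∀ t, Measurable (S t))
    (hne : ∀ s t : ℝ≥0, s ≤ t → P.real {ω | S t ω ≠ S s ω} ≤ jumpMean lam s t)
    (s : ℝ≥0) {φ : ℝ → ℂ} (hφ : Measurable φ) {C : ℝ} (hC : ∀ x, ‖φ x‖ ≤ C)
    {T : ℝ} (hT : 0 ≤ T) :
    ContinuousOn (fun u : ℝ ↦ ∫ ω, φ (S u.toNNReal ω - S s ω) ∂P) (Set.Icc 0 T) := by
  have hC0 : 0 ≤ C := (norm_nonneg _).trans (hC 0)
  have h1 (u v : ℝ) (hu : 0 ≤ u) (huv : u ≤ v) :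
      ‖∫ ω, φ (S v.toNNReal ω - S s ω) ∂P - ∫ ω, φ (S u.toNNReal ω - S s ω) ∂P‖ ≤
        2 * C * |jumpMean lam 0 v - jumpMean lam 0 u| := by
    have hv := hu.trans huv
    refine (norm_integral_comp_sub_le ((S_measurable _).sub (S_measurable s))
      ((S_measurable _).sub (S_measurable s)) hφ hC).trans ?_
    have h2 := hne _ _ (Real.toNNReal_le_toNNReal huv)
    rw [Real.coe_toNNReal _ hu, Real.coe_toNNReal _ hv] at h2
    have h3 := jumpMean_add lam_integrable le_rfl hu hv
    have h4 : {ω | S v.toNNReal ω - S s ω ≠ S u.toNNReal ω - S s ω} =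
        {ω | S v.toNNReal ω ≠ S u.toNNReal ω} := by
      ext ω
      simp
    simp only [Pi.sub_apply]
    rw [h4]
    gcongr
    calc _ ≤ jumpMean lam u v := h2
      _ = jumpMean lam 0 v - jumpMean lam 0 u := by linarith
      _ ≤ _ := le_abs_self _
  intro u hu
  rw [ContinuousWithinAt, tendsto_iff_norm_sub_tendsto_zero]
  have h5 : Tendsto (fun v ↦ 2 * C * |jumpMean lam 0 v - jumpMean lam 0 u|)
      (𝓝[Set.Icc 0 T] u) (𝓝 0) := by
    have := (((continuousOn_jumpMean lam_integrable hT u hu).sub_const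
      (jumpMean lam 0 u)).abs).const_mul (2 * C)
    simpa using this
  refine squeeze_zero' (Eventually.of_forall fun _ ↦ norm_nonneg _) ?_ h5
  filter_upwards [self_mem_nhdsWithin] with v hv
  rcases le_total u v with h | h
  · exact h1 u v hu.1 h
  · rw [norm_sub_rev, abs_sub_comm]
    exact h1 v u hv.1 h

end Estimates

/-! ### The evolution equation and the second-order expansion -/

section Expansion

lemma intervalIntegrable_fun_sum {ι E : Type*} [Fintype ι] [NormedAddCommGroup E]
    {f : ι → ℝ → E} {a b : ℝ} (h : ∀ i, IntervalIntegrable (f i) volume a b) :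
    IntervalIntegrable (fun x ↦ ∑ i, f i x) volume a b := by
  convert! IntervalIntegrable.sum Finset.univ fun i _ ↦ h i
  simp

variable {Ω : Type*} {mΩ : MeasurableSpace Ω} {P : Measure Ω} [IsProbabilityMeasure P]
  {I : Finset ℝ} {lam : I → ℝ → ℝ} {S : ℝ≥0 → Ω → ℝ}

/-- Kolmogorov's forward equation. Over [t, t + h] the increment is independent of S(t) - S(s) and
equals i with probability λ_i(t) h + o(h). The derivative is one-sided but exists at every t ≥ s,
not merely almost everywhere. -/
lemma hasDerivWithinAt_integral_comp_increment (hI : (0 : ℝ) ∉ I)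
    (lam_integrable : ∀ (i : I) (t : ℝ), 0 ≤ t → IntegrableOn (lam i) (Set.Icc 0 t) volume)
    (S_measurable : ∀ t, Measurable (S t)) (S_zero : ∀ᵐ ω ∂P, S 0 ω = 0)
    (hS : IsInfinitesimalSkellam P I lam S) {s t : ℝ≥0} (hst : s ≤ t)
    {ψ : ℝ → ℂ} (hψ : Measurable ψ) (hψ1 : ∀ x, ‖ψ x‖ ≤ 1) :
    HasDerivWithinAt (fun u : ℝ ↦ ∫ ω, ψ (S u.toNNReal ω - S s ω) ∂P)
      (∑ i : I, (lam i t : ℂ) * ∫ ω, (ψ (S t ω - S s ω + i) - ψ (S t ω - S s ω)) ∂P)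
      (Set.Ioi (t : ℝ)) t := by
  set A : I → ℂ := fun i ↦ ∫ ω, (ψ (S t ω - S s ω + i) - ψ (S t ω - S s ω)) ∂P with hA
  have hatom := measure_eq_zero_ne_zero lam_integrable S_measurable S_zero hS t
  obtain ⟨hj1, hj2, -⟩ := hS.jumps t 0 hatom
  simp only [transProb_eq_incProb S_measurable S_zero hS.indep_increments hatom] at hj1 hj2
  have hmain : (fun h : ℝ≥0 ↦ ∫ ω, ψ (S (t + h) ω - S s ω) ∂P - ∫ ω, ψ (S t ω - S s ω) ∂P -
      (h : ℝ) • ∑ i : I, (lam i t : ℂ) * A i) =o[𝓝[>] 0] (fun h : ℝ≥0 ↦ (h : ℝ)) := by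
    -- The relations for the values 0 and i ∈ I add up to 1 - o(h), so all other values together
    -- have probability o(h).
    have hrem : (fun h : ℝ≥0 ↦ 2 * (1 - incProb P S t h 0 - ∑ i : I, incProb P S t h i))
        =o[𝓝[>] 0] (fun h : ℝ≥0 ↦ (h : ℝ)) := by
      have h1 : (fun h : ℝ≥0 ↦ ∑ i : I, (incProb P S t h i - lam i t * (h : ℝ)))
          =o[𝓝[>] 0] (fun h : ℝ≥0 ↦ (h : ℝ)) := IsLittleO.fun_sum fun i _ ↦ hj1 i
      refine ((hj2.add h1).const_mul_left (-2)).congr_left fun h ↦ ?_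
      rw [Finset.sum_sub_distrib]
      ring
    have hlin : (fun h : ℝ≥0 ↦ ∑ i : I, ((incProb P S t h i - lam i t * (h : ℝ) : ℝ) : ℂ) * A i)
        =o[𝓝[>] 0] (fun h : ℝ≥0 ↦ (h : ℝ)) := by
      refine IsLittleO.fun_sum fun i _ ↦ ?_
      have h1 : (fun h : ℝ≥0 ↦ ((incProb P S t h i - lam i t * (h : ℝ) : ℝ) : ℂ))
          =o[𝓝[>] 0] (fun h : ℝ≥0 ↦ (h : ℝ)) := by
        refine (isLittleO_norm_left).1 ?_
        simp only [Complex.norm_real]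
        exact (hj1 i).norm_left
      refine (h1.const_mul_left (A i)).congr_left fun h ↦ mul_comm _ _
    have herr : (fun h : ℝ≥0 ↦ ∫ ω, ψ (S (t + h) ω - S s ω) ∂P - ∫ ω, ψ (S t ω - S s ω) ∂P -
        ∑ i : I, (incProb P S t h i : ℂ) * A i) =o[𝓝[>] 0] (fun h : ℝ≥0 ↦ (h : ℝ)) := by
      refine IsLittleO.trans_isBigO ?_ (isBigO_refl _ _)
      refine IsBigO.trans_isLittleO (IsBigO.of_bound 1 (Eventually.of_forall fun h ↦ ?_)) hrem
      have h1 := norm_integral_add_sub_le hI ((S_measurable t).sub (S_measurable s))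
        ((S_measurable (t + h)).sub (S_measurable t))
        (hS.indep_increments.indepFun_sub_sub hst (le_self_add : t ≤ t + h)) hψ hψ1
      simp only [Pi.sub_apply, sub_add_sub_cancel'] at h1
      rw [one_mul]
      refine h1.trans (le_abs_self _)
    refine (herr.add hlin).congr_left fun h ↦ ?_
    rw [Finset.smul_sum, sub_add, ← Finset.sum_sub_distrib]
    congr 1
    refine Finset.sum_congr rfl fun i _ ↦ ?_
    rw [Complex.real_smul]
    push_cast
    ring
  rw [hasDerivWithinAt_iff_isLittleO]
  refine (hmain.comp_tendsto (tendsto_sub_toNNReal (t : ℝ))).congr' ?_ ?_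
  · filter_upwards [self_mem_nhdsWithin] with u hu
    have hu' : (t : ℝ) < u := hu
    have hadd : t + (u - t).toNNReal = u.toNNReal := by
      ext
      simp [hu'.le, t.2.trans hu'.le]
    simp only [Function.comp_apply, hadd, Real.toNNReal_coe]
    rw [Real.coe_toNNReal _ (by linarith)]
  · filter_upwards [self_mem_nhdsWithin] with u hu
    have hu' : (t : ℝ) < u := hu
    simp only [Function.comp_apply]
    rw [Real.coe_toNNReal _ (by linarith)]

/-- Second-order expansion of `E ψ(S(t) - S(s))`. -/
theorem norm_integral_comp_increment_sub_le (hI : (0 : ℝ) ∉ I)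
    (lam_nonneg : ∀ (i : I) (t : ℝ), 0 ≤ t → 0 ≤ lam i t)
    (lam_integrable : ∀ (i : I) (t : ℝ), 0 ≤ t → IntegrableOn (lam i) (Set.Icc 0 t) volume)
    (S_measurable : ∀ t, Measurable (S t)) (S_zero : ∀ᵐ ω ∂P, S 0 ω = 0)
    (hS : IsInfinitesimalSkellam P I lam S) {s t : ℝ≥0} (hst : s ≤ t)
    {ψ : ℝ → ℂ} (hψ : Measurable ψ) (hψ1 : ∀ x, ‖ψ x‖ ≤ 1) :
    ‖∫ ω, ψ (S t ω - S s ω) ∂P - ψ 0 -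
      ∑ i : I, ((∫ x in (s : ℝ)..t, lam i x : ℝ) : ℂ) * (ψ i - ψ 0)‖ ≤
      4 * jumpMean lam s t ^ 2 := by
  have hne : ∀ s t : ℝ≥0, s ≤ t → P.real {ω | S t ω ≠ S s ω} ≤ jumpMean lam s t :=
    fun s t h ↦ real_ne_le_jumpMean lam_integrable S_measurable S_zero hS h
  have hst' : (s : ℝ) ≤ t := hst
  set φ : I → ℝ → ℂ := fun i x ↦ ψ (x + i) - ψ x with hφ
  have hφm (i : I) : Measurable (φ i) := by fun_prop
  have hφ2 (i : I) (x : ℝ) : ‖φ i x‖ ≤ 2 :=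
    (norm_sub_le _ _).trans (by linarith [hψ1 (x + i), hψ1 x])
  set A : I → ℝ → ℂ := fun i u ↦ ∫ ω, φ i (S u.toNNReal ω - S s ω) ∂P with hA
  have hcontψ := continuousOn_integral_comp_increment lam_integrable S_measurable hne s hψ hψ1
    t.coe_nonneg
  have hcontA (i : I) : ContinuousOn (A i) (Set.uIcc s t) := by
    rw [Set.uIcc_of_le hst']
    exact (continuousOn_integral_comp_increment lam_integrable S_measurable hne s (hφm i) (hφ2 i)
      t.coe_nonneg).mono (Set.Icc_subset_Icc_left s.coe_nonneg)
  have hlam (i : I) : IntervalIntegrable (fun x ↦ (lam i x : ℂ)) volume s t :=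
    let h := intervalIntegrable_rate lam_integrable i s.coe_nonneg t.coe_nonneg
    ⟨h.1.ofReal, h.2.ofReal⟩
  have hint (i : I) : IntervalIntegrable (fun x ↦ (lam i x : ℂ) * A i x) volume s t :=
    (hlam i).mul_continuousOn (hcontA i)
  -- The fundamental theorem needs only continuity and an integrable right derivative at every
  -- interior point; the rates may be discontinuous.
  have hFTC : ∫ u in (s : ℝ)..t, ∑ i : I, (lam i u : ℂ) * A i u =
      ∫ ω, ψ (S t ω - S s ω) ∂P - ψ 0 := by
    have := intervalIntegral.integral_eq_sub_of_hasDeriv_right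
      (f := fun u : ℝ ↦ ∫ ω, ψ (S u.toNNReal ω - S s ω) ∂P)
      (f' := fun u ↦ ∑ i : I, (lam i u : ℂ) * A i u) (a := s) (b := t) ?_ ?_ ?_
    · simpa using this
    · rw [Set.uIcc_of_le hst']
      exact hcontψ.mono (Set.Icc_subset_Icc_left s.coe_nonneg)
    · intro u hu
      rw [min_eq_left hst'] at hu
      have hsu : (s : ℝ) ≤ u := hu.1.le
      lift u to ℝ≥0 using s.coe_nonneg.trans hsu
      have := hasDerivWithinAt_integral_comp_increment hI lam_integrable S_measurable S_zero hS
        (s := s) (t := u) hsu hψ hψ1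
      simpa only [hA, hφ, Real.toNNReal_coe] using this
    · exact intervalIntegrable_fun_sum fun i ↦ hint i
  have hsub : ∑ i : I, ((∫ x in (s : ℝ)..t, lam i x : ℝ) : ℂ) * (ψ i - ψ 0) =
      ∫ u in (s : ℝ)..t, ∑ i : I, (lam i u : ℂ) * (ψ i - ψ 0) := by
    rw [intervalIntegral.integral_finsetSum fun i _ ↦ (hlam i).mul_const _]
    refine Finset.sum_congr rfl fun i _ ↦ ?_
    rw [intervalIntegral.integral_mul_const, intervalIntegral.integral_ofReal]
  rw [← hFTC, hsub, ← intervalIntegral.integral_sub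
    (intervalIntegrable_fun_sum fun i ↦ hint i)
    (intervalIntegrable_fun_sum fun i ↦ (hlam i).mul_const _)]
  -- Replacing S(u) - S(s) by 0 costs 2 · 2 · P{S(u) ≠ S(s)}, since φ_i is bounded by 2; this is the
  -- source of the constant 4.
  have hbound : ∀ u ∈ Set.Icc (s : ℝ) t, ‖∑ i : I, (lam i u : ℂ) * A i u -
      ∑ i : I, (lam i u : ℂ) * (ψ i - ψ 0)‖ ≤ (∑ i : I, lam i u) * (4 * jumpMean lam s t) := by
    intro u hu
    have hu0 : 0 ≤ u := s.coe_nonneg.trans hu.1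
    rw [← Finset.sum_sub_distrib, Finset.sum_mul]
    refine norm_sum_le_of_le _ fun i _ ↦ ?_
    rw [← mul_sub, norm_mul, Complex.norm_real, Real.norm_of_nonneg (lam_nonneg i u hu0)]
    refine mul_le_mul_of_nonneg_left ?_ (lam_nonneg i u hu0)
    have h1 := norm_integral_comp_sub_le (P := P)
      ((S_measurable u.toNNReal).sub (S_measurable s)) (measurable_const (a := (0 : ℝ)))
      (hφm i) (hφ2 i)
    simp only [integral_const, probReal_univ, one_smul, Pi.sub_apply, sub_ne_zero] at h1
    have h2 : φ i 0 = ψ i - ψ 0 := by simp [hφ]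
    rw [h2] at h1
    have h3 := hne s u.toNNReal (NNReal.le_toNNReal_of_coe_le hu.1)
    rw [Real.coe_toNNReal _ hu0] at h3
    have h4 := jumpMean_mono lam_nonneg lam_integrable s.coe_nonneg le_rfl hu.1 hu.2
    calc _ ≤ _ := h1
      _ ≤ 4 * jumpMean lam s t := by linarith
  have hlamsum : IntervalIntegrable (fun x ↦ ∑ i : I, lam i x) volume s t :=
    intervalIntegrable_fun_sum fun i ↦
      intervalIntegrable_rate lam_integrable i s.coe_nonneg t.coe_nonneg
  calc _ ≤ ∫ u in (s : ℝ)..t, (∑ i : I, lam i u) * (4 * jumpMean lam s t) := by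
        apply intervalIntegral.norm_integral_le_of_norm_le hst'
        · exact ae_of_all _ fun u hu ↦ hbound u (Set.Ioc_subset_Icc_self hu)
        · exact hlamsum.mul_const _
    _ = 4 * jumpMean lam s t ^ 2 := by
        rw [intervalIntegral.integral_mul_const,
          ← jumpMean_eq_integral lam_integrable s.coe_nonneg t.coe_nonneg]
        ring

end Expansion

/-! ### Dyadic counts of increments and their stabilisation -/

section Counts

/-- The dyadic time `k / 2 ^ n`. -/
noncomputable def dyadic (n k : ℕ) : ℝ≥0 := k / 2 ^ n

lemma dyadic_mono (n : ℕ) : Monotone (dyadic n) := fun k l h ↦ by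
  unfold dyadic
  gcongr

lemma dyadic_zero (n : ℕ) : dyadic n 0 = 0 := by simp [dyadic]

lemma dyadic_succ_two_mul (n k : ℕ) : dyadic (n + 1) (2 * k) = dyadic n k := by
  unfold dyadic
  push_cast
  rw [pow_succ]
  field_simp

lemma floor_dyadic (n k : ℕ) : ⌊2 ^ n * dyadic n k⌋₊ = k := by
  have : 2 ^ n * dyadic n k = k := by
    unfold dyadic
    field_simp
  rw [this, Nat.floor_natCast]

lemma exists_eq_dyadic_of_le {t : ℝ≥0} {n : ℕ} (h : ∃ a, t = dyadic n a) {m : ℕ} (hm : n ≤ m) :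
    ∃ a, t = dyadic m a := by
  induction m, hm using Nat.le_induction with
  | base => exact h
  | succ m _ ih =>
    obtain ⟨a, ha⟩ := ih
    exact ⟨2 * a, by rw [dyadic_succ_two_mul, ha]⟩

/-- A time is dyadic if it is a multiple of `1 / 2 ^ n` for some `n`. -/
def IsDyadic (t : ℝ≥0) : Prop := ∃ n a, t = dyadic n a

lemma IsDyadic.eventually {t : ℝ≥0} (h : IsDyadic t) :
    ∀ᶠ n in atTop, t = dyadic n ⌊2 ^ n * t⌋₊ := by
  obtain ⟨n, h⟩ := h
  filter_upwards [eventually_ge_atTop n] with m hm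
  obtain ⟨a, rfl⟩ := exists_eq_dyadic_of_le h hm
  rw [floor_dyadic]

lemma isDyadic_dyadic (n k : ℕ) : IsDyadic (dyadic n k) := ⟨n, k, rfl⟩

variable {Ω : Type*} {mΩ : MeasurableSpace Ω}

/-- The increment of `S` over the `k`-th dyadic interval of length `1 / 2 ^ n`. -/
noncomputable def dyadicInc (S : ℝ≥0 → Ω → ℝ) (n k : ℕ) (ω : Ω) : ℝ :=
  S (dyadic n (k + 1)) ω - S (dyadic n k) ω

lemma dyadicInc_eq_add (S : ℝ≥0 → Ω → ℝ) (n k : ℕ) (ω : Ω) :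
    dyadicInc S n k ω = dyadicInc S (n + 1) (2 * k) ω + dyadicInc S (n + 1) (2 * k + 1) ω := by
  simp only [dyadicInc]
  rw [show 2 * k + 1 + 1 = 2 * (k + 1) by ring, dyadic_succ_two_mul, dyadic_succ_two_mul]
  ring

/-- The number of dyadic intervals of length `1 / 2 ^ n` before time `t` over which the increment
of `S` is `x`. -/
noncomputable def dyadicCount (S : ℝ≥0 → Ω → ℝ) (x : ℝ) (n : ℕ) (t : ℝ≥0) (ω : Ω) : ℕ :=
  ∑ k ∈ Finset.range ⌊2 ^ n * t⌋₊, if dyadicInc S n k ω = x then 1 else 0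

lemma dyadicCount_mono (S : ℝ≥0 → Ω → ℝ) (x : ℝ) (n : ℕ) (ω : Ω) :
    Monotone fun t ↦ dyadicCount S x n t ω := by
  intro s t hst
  refine Finset.sum_le_sum_of_subset (Finset.range_subset_range.2 ?_)
  gcongr

variable {P : Measure Ω} {S : ℝ≥0 → Ω → ℝ}

lemma measurable_dyadicInc (hS : ∀ t, Measurable (S t)) (n k : ℕ) :
    Measurable (dyadicInc S n k) := (hS _).sub (hS _)

lemma measurable_dyadicCount (hS : ∀ t, Measurable (S t)) (x : ℝ) (n : ℕ) (t : ℝ≥0) :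
    Measurable (dyadicCount S x n t) := by
  unfold dyadicCount
  refine Finset.measurable_fun_sum _ fun k _ ↦ ?_
  exact Measurable.ite (measurable_dyadicInc hS n k (measurableSet_singleton _))
    measurable_const measurable_const

/-- If at most one half of each coarse interval moves, the coarse increment is that of the moving
half; the other half is not counted because x ≠ 0. The two counts then agree. -/
lemma exists_of_dyadicCount_ne {x : ℝ} (hx : x ≠ 0) (n a : ℕ) {ω : Ω}
    (h : dyadicCount S x (n + 1) (dyadic n a) ω ≠ dyadicCount S x n (dyadic n a) ω) :
    ∃ k ∈ Finset.range a, dyadicInc S (n + 1) (2 * k) ω ≠ 0 ∧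
      dyadicInc S (n + 1) (2 * k + 1) ω ≠ 0 := by
  by_contra! hcon
  apply h
  unfold dyadicCount
  rw [floor_dyadic, ← dyadic_succ_two_mul, floor_dyadic]
  clear h
  induction a with
  | zero => simp
  | succ a ih =>
    rw [show 2 * (a + 1) = 2 * a + 1 + 1 by ring, Finset.sum_range_succ, Finset.sum_range_succ,
      Finset.sum_range_succ, ih fun k hk ↦ hcon k (by simp at hk ⊢; omega),
      dyadicInc_eq_add S n a]
    have := hcon a (by simp)
    by_cases h0 : dyadicInc S (n + 1) (2 * a) ω = 0
    · simp [h0, hx.symm]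
    · simp [this h0, hx.symm]

/-- The properties of a process satisfying the infinitesimal description from which the counting
processes of its jumps are constructed. -/
structure SmallJumpEstimates (P : Measure Ω) (I : Finset ℝ) (lam : I → ℝ → ℝ)
    (S : ℝ≥0 → Ω → ℝ) : Prop where
  zero_notMem : (0 : ℝ) ∉ I
  rate_nonneg : ∀ (i : I) (t : ℝ), 0 ≤ t → 0 ≤ lam i t
  rate_integrable : ∀ (i : I) (t : ℝ), 0 ≤ t → IntegrableOn (lam i) (Set.Icc 0 t) volume
  measurable : ∀ t, Measurable (S t)
  zero_ae : ∀ᵐ ω ∂P, S 0 ω = 0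
  indep : HasIndepIncrements S P
  stoch_continuous : StochContinuous P S
  real_ne_le : ∀ s t : ℝ≥0, s ≤ t → P.real {ω | S t ω ≠ S s ω} ≤ jumpMean lam s t
  expansion : ∀ s t : ℝ≥0, s ≤ t → ∀ ψ : ℝ → ℂ, Measurable ψ → (∀ x, ‖ψ x‖ ≤ 1) →
    ‖∫ ω, ψ (S t ω - S s ω) ∂P - ψ 0 -
      ∑ i : I, ((∫ x in (s : ℝ)..t, lam i x : ℝ) : ℂ) * (ψ i - ψ 0)‖ ≤
      4 * jumpMean lam s t ^ 2

variable {I : Finset ℝ} {lam : I → ℝ → ℝ}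

lemma IsInfinitesimalSkellam.smallJumpEstimates [IsProbabilityMeasure P] (hI : (0 : ℝ) ∉ I)
    (lam_nonneg : ∀ (i : I) (t : ℝ), 0 ≤ t → 0 ≤ lam i t)
    (lam_integrable : ∀ (i : I) (t : ℝ), 0 ≤ t → IntegrableOn (lam i) (Set.Icc 0 t) volume)
    (S_measurable : ∀ t, Measurable (S t)) (S_zero : ∀ᵐ ω ∂P, S 0 ω = 0)
    (hS : IsInfinitesimalSkellam P I lam S) : SmallJumpEstimates P I lam S where
  zero_notMem := hI
  rate_nonneg := lam_nonneg
  rate_integrable := lam_integrable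
  measurable := S_measurable
  zero_ae := S_zero
  indep := hS.indep_increments
  stoch_continuous := hS.stoch_continuous
  real_ne_le _ _ hst := real_ne_le_jumpMean lam_integrable S_measurable S_zero hS hst
  expansion _ _ hst _ hψ hψ1 := norm_integral_comp_increment_sub_le hI lam_nonneg lam_integrable
    S_measurable S_zero hS hst hψ hψ1

/-- The mean number of jumps in the `k`-th dyadic interval of length `1 / 2 ^ n`. -/
noncomputable def dyadicMean (lam : I → ℝ → ℝ) (n k : ℕ) : ℝ :=
  jumpMean lam (dyadic n k) (dyadic n (k + 1))

/-- The sum of the squares of the mean numbers of jumps in the first `a` dyadic intervals of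
length `1 / 2 ^ n`. -/
noncomputable def sqMean (lam : I → ℝ → ℝ) (n a : ℕ) : ℝ :=
  ∑ k ∈ Finset.range a, dyadicMean lam n k ^ 2

lemma sqMean_nonneg (n a : ℕ) : 0 ≤ sqMean lam n a := Finset.sum_nonneg fun _ _ ↦ sq_nonneg _

namespace SmallJumpEstimates

lemma dyadicMean_nonneg (hE : SmallJumpEstimates P I lam S)
    (n k : ℕ) : 0 ≤ dyadicMean lam n k :=
  jumpMean_nonneg hE.rate_nonneg (NNReal.coe_nonneg _) (dyadic_mono n (Nat.le_succ k))

lemma sum_dyadicMean (hE : SmallJumpEstimates P I lam S)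
    (n a : ℕ) :
    ∑ k ∈ Finset.range a, dyadicMean lam n k = jumpMean lam 0 (dyadic n a) := by
  induction a with
  | zero => simp [dyadic_zero, jumpMean]
  | succ a ih =>
    rw [Finset.sum_range_succ, ih, dyadicMean]
    exact jumpMean_add hE.rate_integrable le_rfl (NNReal.coe_nonneg _) (NNReal.coe_nonneg _)

lemma dyadicMean_eq_add (hE : SmallJumpEstimates P I lam S)
    (n k : ℕ) :
    dyadicMean lam n k = dyadicMean lam (n + 1) (2 * k) + dyadicMean lam (n + 1) (2 * k + 1) := by
  simp only [dyadicMean]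
  rw [show 2 * k + 1 + 1 = 2 * (k + 1) by ring, dyadic_succ_two_mul, dyadic_succ_two_mul]
  exact (jumpMean_add hE.rate_integrable (NNReal.coe_nonneg _) (NNReal.coe_nonneg _)
    (NNReal.coe_nonneg _)).symm

/-- (p + q)² - p² - q² = 2pq on each interval. This turns the bounds on the probability of a change
of count into a telescoping sequence. -/
lemma sqMean_sub (hE : SmallJumpEstimates P I lam S)
    (n a : ℕ) :
    sqMean lam n a - sqMean lam (n + 1) (2 * a) =
      2 * ∑ k ∈ Finset.range a, dyadicMean lam (n + 1) (2 * k) *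
        dyadicMean lam (n + 1) (2 * k + 1) := by
  unfold sqMean
  induction a with
  | zero => simp
  | succ a ih =>
    rw [show 2 * (a + 1) = 2 * a + 1 + 1 by ring, Finset.sum_range_succ, Finset.sum_range_succ,
      Finset.sum_range_succ, Finset.sum_range_succ, mul_add, ← ih, hE.dyadicMean_eq_add n a]
    ring

lemma real_dyadicInc_ne_le (hE : SmallJumpEstimates P I lam S)
    (n k : ℕ) :
    P.real {ω | dyadicInc S n k ω ≠ 0} ≤ dyadicMean lam n k := by
  have := hE.real_ne_le _ _ (dyadic_mono n (Nat.le_succ k))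
  simpa only [dyadicInc, sub_ne_zero, dyadicMean] using this

lemma iIndepFun_dyadicInc (hE : SmallJumpEstimates P I lam S)
    (n : ℕ) : iIndepFun (dyadicInc S n) P :=
  hE.indep.nat (dyadic_mono n)

/-- Union bound over the coarse intervals: the two halves are independent and each moves with
probability at most its mean. -/
lemma real_dyadicCount_ne_le [IsProbabilityMeasure P] (hE : SmallJumpEstimates P I lam S)
    (i : I) (n a : ℕ) :
    P.real {ω | dyadicCount S i (n + 1) (dyadic n a) ω ≠ dyadicCount S i n (dyadic n a) ω} ≤
      (sqMean lam n a - sqMean lam (n + 1) (2 * a)) / 2 := by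
  have hi : (i : ℝ) ≠ 0 := fun h ↦ hE.zero_notMem (h ▸ i.2)
  calc
    _ ≤ P.real (⋃ k ∈ Finset.range a, {ω | dyadicInc S (n + 1) (2 * k) ω ≠ 0 ∧
          dyadicInc S (n + 1) (2 * k + 1) ω ≠ 0}) := by
      refine measureReal_mono (fun ω hω ↦ ?_) (measure_ne_top _ _)
      simpa only [Set.mem_iUnion, exists_prop] using! exists_of_dyadicCount_ne hi n a hω
    _ ≤ ∑ k ∈ Finset.range a, P.real {ω | dyadicInc S (n + 1) (2 * k) ω ≠ 0 ∧
          dyadicInc S (n + 1) (2 * k + 1) ω ≠ 0} := measureReal_biUnion_finset_le _ _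
    _ ≤ ∑ k ∈ Finset.range a, dyadicMean lam (n + 1) (2 * k) *
        dyadicMean lam (n + 1) (2 * k + 1) := by
      refine Finset.sum_le_sum fun k _ ↦ ?_
      have h1 := ((hE.iIndepFun_dyadicInc (n + 1)).indepFun
        (show 2 * k ≠ 2 * k + 1 by omega)).measure_inter_preimage_eq_mul {0}ᶜ {0}ᶜ
        (measurableSet_singleton _).compl (measurableSet_singleton _).compl
      have h2 := congrArg ENNReal.toReal h1
      rw [ENNReal.toReal_mul] at h2
      refine h2.le.trans ?_
      exact mul_le_mul (hE.real_dyadicInc_ne_le _ _) (hE.real_dyadicInc_ne_le _ _)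
        measureReal_nonneg (hE.dyadicMean_nonneg _ _)
    _ = _ := by rw [hE.sqMean_sub]; ring

/-- At a dyadic time, the dyadic counts are almost surely eventually constant. -/
theorem ae_exists_eventually_eq [IsProbabilityMeasure P] (hE : SmallJumpEstimates P I lam S)
    (i : I) {t : ℝ≥0} (ht : IsDyadic t) :
    ∀ᵐ ω ∂P, ∃ l, ∀ᶠ n in atTop, dyadicCount S i n t ω = l := by
  obtain ⟨n₀, a, rfl⟩ := ht
  set q : ℕ → ℝ := fun m ↦ sqMean lam (n₀ + m) (2 ^ m * a) with hq
  set B : ℕ → Set Ω := fun m ↦ {ω | dyadicCount S i (n₀ + m + 1) (dyadic n₀ a) ω ≠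
    dyadicCount S i (n₀ + m) (dyadic n₀ a) ω} with hB
  have hdy (m : ℕ) : dyadic n₀ a = dyadic (n₀ + m) (2 ^ m * a) := by
    induction m with
    | zero => simp
    | succ m ih => rw [ih, ← add_assoc, pow_succ', mul_assoc, dyadic_succ_two_mul]
  have hPB (m : ℕ) : P.real (B m) ≤ (q m - q (m + 1)) / 2 := by
    have := hE.real_dyadicCount_ne_le i (n₀ + m) (2 ^ m * a)
    rw [← hdy] at this
    simp only [hq, hB]
    rw [pow_succ', mul_assoc, ← add_assoc]
    exact this
  -- Telescoping bounds the total by q(0) / 2 with no quantitative modulus of continuity for the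
  -- primitives; Borel–Cantelli then applies.
  have hsumm : Summable fun m ↦ P.real (B m) := by
    refine summable_of_sum_range_le (c := q 0 / 2) (fun _ ↦ measureReal_nonneg) fun n ↦ ?_
    calc _ ≤ ∑ m ∈ Finset.range n, (q m - q (m + 1)) / 2 :=
          Finset.sum_le_sum fun m _ ↦ hPB m
      _ = (q 0 - q n) / 2 := by rw [← Finset.sum_div, Finset.sum_range_sub']
      _ ≤ q 0 / 2 := by
        have : 0 ≤ q n := sqMean_nonneg _ _
        linarith
  have hne : ∑' m, P (B m) ≠ ∞ := by
    have h1 : ∀ m, P (B m) = ENNReal.ofReal (P.real (B m)) := fun m ↦ by simp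
    simp_rw [h1]
    rw [← ENNReal.ofReal_tsum_of_nonneg (fun _ ↦ measureReal_nonneg) hsumm]
    exact ENNReal.ofReal_ne_top
  filter_upwards [ae_eventually_notMem hne] with ω hω
  obtain ⟨m₀, hm₀⟩ := eventually_atTop.1 hω
  refine ⟨dyadicCount S i (n₀ + m₀) (dyadic n₀ a) ω, eventually_atTop.2 ⟨n₀ + m₀, fun n hn ↦ ?_⟩⟩
  induction n, hn using Nat.le_induction with
  | base => rfl
  | succ n hn ih =>
    obtain ⟨m, rfl⟩ := Nat.exists_eq_add_of_le (le_of_add_le_left hn)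
    have := hm₀ m (by omega)
    simp only [hB, Set.mem_ofPred_eq, not_not] at this
    rw [this, ih]

end SmallJumpEstimates

end Counts

/-! ### Convergence to compound Poisson characteristic functions -/

section CharFun

lemma norm_prod_sub_prod_le {ι : Type*} (s : Finset ι) {z w : ι → ℂ} (hz : ∀ i ∈ s, ‖z i‖ ≤ 1)
    (hw : ∀ i ∈ s, ‖w i‖ ≤ 1) :
    ‖∏ i ∈ s, z i - ∏ i ∈ s, w i‖ ≤ ∑ i ∈ s, ‖z i - w i‖ := by
  classical
  induction s using Finset.induction_on with
  | empty => simp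
  | insert a s ha ih =>
    rw [Finset.prod_insert ha, Finset.prod_insert ha, Finset.sum_insert ha]
    have h1 : ‖∏ i ∈ s, z i‖ ≤ 1 := by
      rw [norm_prod]
      exact Finset.prod_le_one (fun _ _ ↦ norm_nonneg _)
        fun i hi ↦ hz i (Finset.mem_insert_of_mem hi)
    have h2 := ih (fun i hi ↦ hz i (Finset.mem_insert_of_mem hi))
      (fun i hi ↦ hw i (Finset.mem_insert_of_mem hi))
    have h3 := hw a (Finset.mem_insert_self a s)
    calc ‖z a * ∏ i ∈ s, z i - w a * ∏ i ∈ s, w i‖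
        = ‖(z a - w a) * ∏ i ∈ s, z i + w a * (∏ i ∈ s, z i - ∏ i ∈ s, w i)‖ := by ring_nf
      _ ≤ ‖z a - w a‖ * ‖∏ i ∈ s, z i‖ + ‖w a‖ * ‖∏ i ∈ s, z i - ∏ i ∈ s, w i‖ := by
        rw [← norm_mul, ← norm_mul]
        exact norm_add_le _ _
      _ ≤ ‖z a - w a‖ * 1 + 1 * ∑ i ∈ s, ‖z i - w i‖ := by gcongr
      _ = _ := by ring

/-- For ‖a‖ ≤ 1 this is the Taylor bound; for ‖a‖ ≥ 1 each of the three terms is at most ‖a‖², the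
exponential because Re a ≤ 0. -/
lemma norm_exp_sub_one_sub_le_of_re_nonpos {a : ℂ} (ha : a.re ≤ 0) :
    ‖Complex.exp a - 1 - a‖ ≤ 3 * ‖a‖ ^ 2 := by
  rcases le_total ‖a‖ 1 with h | h
  · have := Complex.norm_exp_sub_one_sub_id_le h
    nlinarith [sq_nonneg ‖a‖]
  · have h1 : ‖Complex.exp a‖ ≤ 1 := by
      rw [Complex.norm_exp]
      exact Real.exp_le_one_iff.2 ha
    calc _ ≤ ‖Complex.exp a‖ + ‖(1 : ℂ)‖ + ‖a‖ := (norm_sub_le _ _).trans (by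
          gcongr; exact norm_sub_le _ _)
      _ ≤ 3 * ‖a‖ ^ 2 := by
        rw [norm_one]
        nlinarith

variable {Ω : Type*} {mΩ : MeasurableSpace Ω} {P : Measure Ω} {S : ℝ≥0 → Ω → ℝ}
  {I : Finset ℝ} {lam : I → ℝ → ℝ}

lemma dyadic_floor_le (n : ℕ) (t : ℝ≥0) : dyadic n ⌊2 ^ n * t⌋₊ ≤ t := by
  unfold dyadic
  rw [div_le_iff₀ (by positivity), mul_comm]
  exact Nat.floor_le zero_le

lemma dyadic_succ_sub (n k : ℕ) : (dyadic n (k + 1) : ℝ) - dyadic n k = (1 / 2) ^ n := by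
  simp only [dyadic]
  push_cast
  rw [div_pow, one_pow]
  ring

namespace SmallJumpEstimates

/-- The sum of squares is at most the largest mean times the total mean, and the largest mean tends
to 0 because the primitive is uniformly continuous on [0, t]. -/
lemma tendsto_sqMean (hE : SmallJumpEstimates P I lam S) (t : ℝ≥0) :
    Tendsto (fun n ↦ sqMean lam n ⌊2 ^ n * t⌋₊) atTop (𝓝 0) := by
  have hM : 0 ≤ jumpMean lam 0 t := jumpMean_nonneg hE.rate_nonneg le_rfl t.coe_nonneg
  have huc := isCompact_Icc.uniformContinuousOn_of_continuous
    (continuousOn_jumpMean hE.rate_integrable t.coe_nonneg)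
  rw [Metric.uniformContinuousOn_iff] at huc
  rw [Metric.tendsto_atTop]
  intro ε hε
  obtain ⟨δ, hδ, H⟩ := huc (ε / (jumpMean lam 0 t + 1)) (by positivity)
  obtain ⟨N, hN⟩ := exists_pow_lt_of_lt_one hδ (by norm_num : (1 / 2 : ℝ) < 1)
  refine ⟨N, fun n hn ↦ ?_⟩
  rw [Real.dist_eq, sub_zero, abs_of_nonneg (sqMean_nonneg _ _)]
  have hle : ∀ k ∈ Finset.range ⌊2 ^ n * t⌋₊,
      dyadicMean lam n k ≤ ε / (jumpMean lam 0 t + 1) := by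
    intro k hk
    have h1 : dyadic n (k + 1) ≤ t :=
      (dyadic_mono n (Nat.succ_le_of_lt (Finset.mem_range.1 hk))).trans (dyadic_floor_le n t)
    have h0 : dyadic n k ≤ t := (dyadic_mono n (Nat.le_succ k)).trans h1
    have h2 := H (dyadic n (k + 1)) ⟨NNReal.coe_nonneg _, h1⟩ (dyadic n k)
      ⟨NNReal.coe_nonneg _, h0⟩ (by
        rw [Real.dist_eq, dyadic_succ_sub, abs_of_nonneg (by positivity)]
        exact (pow_le_pow_of_le_one (by norm_num) (by norm_num) hn).trans_lt hN)
    have h3 := jumpMean_add hE.rate_integrable le_rfl (NNReal.coe_nonneg (dyadic n k))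
      (NNReal.coe_nonneg (dyadic n (k + 1)))
    rw [Real.dist_eq] at h2
    have h4 := (le_abs_self _).trans h2.le
    rw [dyadicMean]
    linarith
  calc sqMean lam n ⌊2 ^ n * t⌋₊
      ≤ ∑ k ∈ Finset.range ⌊2 ^ n * t⌋₊, ε / (jumpMean lam 0 t + 1) * dyadicMean lam n k := by
        refine Finset.sum_le_sum fun k hk ↦ ?_
        rw [sq]
        exact mul_le_mul_of_nonneg_right (hle k hk) (hE.dyadicMean_nonneg n k)
    _ = ε / (jumpMean lam 0 t + 1) * jumpMean lam 0 (dyadic n ⌊2 ^ n * t⌋₊) := by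
        rw [← Finset.mul_sum, hE.sum_dyadicMean]
    _ ≤ ε / (jumpMean lam 0 t + 1) * jumpMean lam 0 t := by
        refine mul_le_mul_of_nonneg_left ?_ (by positivity)
        exact jumpMean_mono hE.rate_nonneg hE.rate_integrable le_rfl le_rfl
          (NNReal.coe_nonneg _) (dyadic_floor_le n t)
    _ < ε := by
        rw [div_mul_eq_mul_div, div_lt_iff₀ (by positivity)]
        nlinarith

/-- The exponent of the compound Poisson law over the time interval `[s, t]`. -/
noncomputable def _root_.Skellam.compoundExponent (lam : I → ℝ → ℝ) (ψ : ℝ → ℂ) (s t : ℝ) : ℂ :=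
  ∑ i : I, ((∫ x in s..t, lam i x : ℝ) : ℂ) * (ψ i - 1)

lemma compoundExponent_re_nonpos (hE : SmallJumpEstimates P I lam S) {ψ : ℝ → ℂ}
    (hψ1 : ∀ x, ‖ψ x‖ ≤ 1) {s t : ℝ} (hs : 0 ≤ s) (hst : s ≤ t) :
    (compoundExponent lam ψ s t).re ≤ 0 := by
  rw [compoundExponent, Complex.re_sum]
  refine Finset.sum_nonpos fun i _ ↦ ?_
  rw [Complex.re_ofReal_mul]
  refine mul_nonpos_of_nonneg_of_nonpos (integral_rate_nonneg hE.rate_nonneg i hs hst) ?_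
  have := (Complex.re_le_norm (ψ i)).trans (hψ1 i)
  simpa using this

lemma norm_compoundExponent_le (hE : SmallJumpEstimates P I lam S) {ψ : ℝ → ℂ}
    (hψ1 : ∀ x, ‖ψ x‖ ≤ 1) {s t : ℝ} (hs : 0 ≤ s) (hst : s ≤ t) :
    ‖compoundExponent lam ψ s t‖ ≤ 2 * jumpMean lam s t := by
  rw [compoundExponent, jumpMean, Finset.mul_sum]
  refine norm_sum_le_of_le _ fun i _ ↦ ?_
  have h0 := integral_rate_nonneg hE.rate_nonneg i hs hst
  rw [norm_mul, Complex.norm_real, Real.norm_of_nonneg h0, mul_comm]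
  refine mul_le_mul_of_nonneg_right ?_ h0
  calc _ ≤ ‖ψ i‖ + ‖(1 : ℂ)‖ := norm_sub_le _ _
    _ ≤ 2 := by rw [norm_one]; linarith [hψ1 i]

lemma sum_compoundExponent (hE : SmallJumpEstimates P I lam S) (ψ : ℝ → ℂ) (n : ℕ) {a b : ℕ}
    (hab : a ≤ b) :
    ∑ k ∈ Finset.Ico a b, compoundExponent lam ψ (dyadic n k) (dyadic n (k + 1)) =
      compoundExponent lam ψ (dyadic n a) (dyadic n b) := by
  induction b, hab using Nat.le_induction with
  | base => simp [compoundExponent]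
  | succ b hab ih =>
    rw [Finset.sum_Ico_succ_top hab, ih]
    simp only [compoundExponent]
    rw [← Finset.sum_add_distrib]
    refine Finset.sum_congr rfl fun i _ ↦ ?_
    rw [← intervalIntegral.integral_add_adjacent_intervals
      (intervalIntegrable_rate hE.rate_integrable i (NNReal.coe_nonneg (dyadic n a))
        (NNReal.coe_nonneg (dyadic n b)))
      (intervalIntegrable_rate hE.rate_integrable i (NNReal.coe_nonneg (dyadic n b))
        (NNReal.coe_nonneg (dyadic n (b + 1))))]
    push_cast
    ring

/-- The law of the sum of a function of the dyadic increments over `[s, t]` converges to a compound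
Poisson law. -/
theorem tendsto_prod_integral_dyadicInc [IsProbabilityMeasure P]
    (hE : SmallJumpEstimates P I lam S) {s t : ℝ≥0}
    (hs : IsDyadic s) (ht : IsDyadic t) (hst : s ≤ t) {ψ : ℝ → ℂ} (hψ : Measurable ψ)
    (hψ1 : ∀ x, ‖ψ x‖ ≤ 1) (hψ0 : ψ 0 = 1) :
    Tendsto (fun n ↦ ∏ k ∈ Finset.Ico ⌊2 ^ n * s⌋₊ ⌊2 ^ n * t⌋₊,
      ∫ ω, ψ (dyadicInc S n k ω) ∂P) atTop (𝓝 (Complex.exp (compoundExponent lam ψ s t))) := by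
  rw [tendsto_iff_norm_sub_tendsto_zero]
  have hlim : Tendsto (fun n ↦ 16 * sqMean lam n ⌊2 ^ n * t⌋₊) atTop (𝓝 0) := by
    simpa using (hE.tendsto_sqMean t).const_mul 16
  refine squeeze_zero' (Eventually.of_forall fun _ ↦ norm_nonneg _) ?_ hlim
  filter_upwards [hs.eventually, ht.eventually] with n hsn htn
  have hab : ⌊2 ^ n * s⌋₊ ≤ ⌊2 ^ n * t⌋₊ := by gcongr
  have hexp : Complex.exp (compoundExponent lam ψ s t) =
      ∏ k ∈ Finset.Ico ⌊2 ^ n * s⌋₊ ⌊2 ^ n * t⌋₊,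
        Complex.exp (compoundExponent lam ψ (dyadic n k) (dyadic n (k + 1))) := by
    rw [← Complex.exp_sum, hE.sum_compoundExponent ψ n hab, ← hsn, ← htn]
  rw [hexp]
  have hk (k : ℕ) : (dyadic n k : ℝ) ≤ dyadic n (k + 1) := dyadic_mono n (Nat.le_succ k)
  calc _ ≤ ∑ k ∈ Finset.Ico ⌊2 ^ n * s⌋₊ ⌊2 ^ n * t⌋₊, ‖∫ ω, ψ (dyadicInc S n k ω) ∂P -
        Complex.exp (compoundExponent lam ψ (dyadic n k) (dyadic n (k + 1)))‖ := by
        refine norm_prod_sub_prod_le _ (fun k _ ↦ ?_) (fun k _ ↦ ?_)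
        · refine (norm_integral_le_of_norm_le_const (ae_of_all _ fun ω ↦ hψ1 _)).trans ?_
          simp
        · rw [Complex.norm_exp]
          exact Real.exp_le_one_iff.2
            (hE.compoundExponent_re_nonpos hψ1 (NNReal.coe_nonneg _) (hk k))
    -- With μ the mean of the interval, 16 μ² is 4 μ² from the expansion plus 3 (2μ)² from replacing
    -- 1 + E by exp E.
    _ ≤ ∑ k ∈ Finset.Ico ⌊2 ^ n * s⌋₊ ⌊2 ^ n * t⌋₊, 16 * dyadicMean lam n k ^ 2 := by
        refine Finset.sum_le_sum fun k _ ↦ ?_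
        have h1 := hE.expansion _ _ (dyadic_mono n (Nat.le_succ k)) ψ hψ hψ1
        rw [hψ0] at h1
        have h2 := norm_exp_sub_one_sub_le_of_re_nonpos
          (hE.compoundExponent_re_nonpos hψ1 (NNReal.coe_nonneg _) (hk k))
        have h3 := hE.norm_compoundExponent_le hψ1 (NNReal.coe_nonneg _) (hk k)
        have h4 := pow_le_pow_left₀ (norm_nonneg _) h3 2
        set E := compoundExponent lam ψ (dyadic n k) (dyadic n (k + 1)) with hEdef
        set Z := ∫ ω, ψ (dyadicInc S n k ω) ∂P
        have h1' : ‖Z - 1 - E‖ ≤ 4 * dyadicMean lam n k ^ 2 := h1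
        have h4' : ‖E‖ ^ 2 ≤ (2 * dyadicMean lam n k) ^ 2 := h4
        calc ‖Z - Complex.exp E‖ = ‖(Z - 1 - E) - (Complex.exp E - 1 - E)‖ := by
              ring_nf
          _ ≤ ‖Z - 1 - E‖ + ‖Complex.exp E - 1 - E‖ := norm_sub_le _ _
          _ ≤ 16 * dyadicMean lam n k ^ 2 := by nlinarith
    _ ≤ ∑ k ∈ Finset.range ⌊2 ^ n * t⌋₊, 16 * dyadicMean lam n k ^ 2 := by
        refine Finset.sum_le_sum_of_subset_of_nonneg ?_ fun _ _ _ ↦ by positivity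
        intro k hk
        simp only [Finset.mem_Ico, Finset.mem_range] at hk ⊢
        exact hk.2
    _ = _ := by rw [← Finset.mul_sum, sqMean]

end SmallJumpEstimates

end CharFun

/-! ### Joint characteristic functions of the counts -/

section JointCharFun

variable {Ω : Type*} {mΩ : MeasurableSpace Ω} {P : Measure Ω} {S : ℝ≥0 → Ω → ℝ}
  {I : Finset ℝ} {lam : I → ℝ → ℝ}

/-- A linear combination of the increments of the processes `N i` between the times `t k`. -/
noncomputable def incSum (N : I → ℝ≥0 → Ω → ℕ) {K : ℕ} (t : Fin (K + 1) → ℝ≥0)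
    (θ : Fin K → I → ℝ) (ω : Ω) : ℝ :=
  ∑ k, ∑ i, θ k i * ((N i (t k.succ) ω : ℝ) - N i (t k.castSucc) ω)

/-- The joint characteristic function of the increments of the processes `N i` between times in `D`
is that of independent Poisson processes. -/
def HasPoissonCharFun (P : Measure Ω) (lam : I → ℝ → ℝ) (N : I → ℝ≥0 → Ω → ℕ) (D : Set ℝ≥0) :
    Prop :=
  ∀ (K : ℕ) (t : Fin (K + 1) → ℝ≥0), Monotone t → (∀ k, t k ∈ D) → ∀ θ : Fin K → I → ℝ,
    ∫ ω, Complex.exp (incSum N t θ ω * Complex.I) ∂P =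
      ∏ k, Complex.exp (∑ i, ((∫ x in (t k.castSucc : ℝ)..t k.succ, lam i x : ℝ) : ℂ) *
        (Complex.exp (θ k i * Complex.I) - 1))

/-- The contribution of a single increment of size `x` to the joint characteristic function. -/
noncomputable def jumpPhase (θ : I → ℝ) (x : ℝ) : ℂ :=
  Complex.exp ((∑ i : I, θ i * (if x = i then (1 : ℝ) else 0) : ℝ) * Complex.I)

lemma measurable_jumpPhase (θ : I → ℝ) : Measurable (jumpPhase θ) := by
  unfold jumpPhase
  refine Complex.measurable_exp.comp ((Complex.measurable_ofReal.comp ?_).mul_const _)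
  refine Finset.measurable_fun_sum _ fun i _ ↦ Measurable.const_mul ?_ _
  exact Measurable.ite (measurableSet_singleton _) measurable_const measurable_const

lemma norm_jumpPhase (θ : I → ℝ) (x : ℝ) : ‖jumpPhase θ x‖ ≤ 1 := by
  rw [jumpPhase, Complex.norm_exp_ofReal_mul_I]

lemma jumpPhase_coe (θ : I → ℝ) (i : I) : jumpPhase θ i = Complex.exp (θ i * Complex.I) := by
  have : ∀ j : I, ((i : ℝ) = j) ↔ i = j := fun j ↦ Subtype.ext_iff.symm
  simp [jumpPhase, this]

lemma jumpPhase_zero (hI : (0 : ℝ) ∉ I) (θ : I → ℝ) : jumpPhase θ 0 = 1 := by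
  have : ∀ j : I, (0 : ℝ) ≠ j := fun j h ↦ hI (h ▸ j.2)
  simp [jumpPhase, this]

lemma dyadicCount_sub (x : ℝ) (n : ℕ) {s t : ℝ≥0} (hst : s ≤ t) (ω : Ω) :
    (dyadicCount S x n t ω : ℝ) - dyadicCount S x n s ω =
      ∑ l ∈ Finset.Ico ⌊2 ^ n * s⌋₊ ⌊2 ^ n * t⌋₊,
        if dyadicInc S n l ω = x then (1 : ℝ) else 0 := by
  rw [Finset.sum_Ico_eq_sub _ (by gcongr), dyadicCount, dyadicCount]
  push_cast
  rfl

lemma exp_incSum_dyadicCount (n : ℕ) {K : ℕ} {t : Fin (K + 1) → ℝ≥0} (ht : Monotone t)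
    (θ : Fin K → I → ℝ) (ω : Ω) :
    Complex.exp (incSum (fun i : I ↦ dyadicCount S i n) t θ ω * Complex.I) =
      ∏ k : Fin K, ∏ l ∈ Finset.Ico ⌊2 ^ n * t k.castSucc⌋₊ ⌊2 ^ n * t k.succ⌋₊,
        jumpPhase (θ k) (dyadicInc S n l ω) := by
  simp only [jumpPhase, ← Complex.exp_sum, ← Finset.sum_mul, ← Complex.ofReal_sum]
  congr 3
  rw [incSum]
  refine Finset.sum_congr rfl fun k _ ↦ ?_
  rw [Finset.sum_comm]
  refine Finset.sum_congr rfl fun i _ ↦ ?_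
  rw [dyadicCount_sub _ _ (ht (Fin.castSucc_le_succ k)), Finset.mul_sum]

namespace SmallJumpEstimates

lemma integral_exp_incSum_dyadicCount (hE : SmallJumpEstimates P I lam S) (n : ℕ) {K : ℕ}
    {t : Fin (K + 1) → ℝ≥0} (ht : Monotone t) (θ : Fin K → I → ℝ) :
    ∫ ω, Complex.exp (incSum (fun i : I ↦ dyadicCount S i n) t θ ω * Complex.I) ∂P =
      ∏ k : Fin K, ∏ l ∈ Finset.Ico ⌊2 ^ n * t k.castSucc⌋₊ ⌊2 ^ n * t k.succ⌋₊,
        ∫ ω, jumpPhase (θ k) (dyadicInc S n l ω) ∂P := by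
  set a : Fin (K + 1) → ℕ := fun k ↦ ⌊2 ^ n * t k⌋₊ with ha
  have hamono : Monotone a := fun k l hkl ↦ by
    have := ht hkl
    simp only [ha]
    gcongr
  let J := Σ k : Fin K, Finset.Ico (a k.castSucc) (a k.succ)
  let g : J → ℕ := fun j ↦ j.2
  -- The blocks of grid indices are disjoint since `t` is monotone, so every grid increment enters
  -- once and mutual independence applies to the whole double product.
  have hg : Function.Injective g := by
    rintro ⟨k, l, hl⟩ ⟨k', l', hl'⟩ h
    obtain rfl : l = l' := h
    rw [Finset.mem_Ico] at hl hl'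
    obtain rfl : k = k' := by
      rcases lt_trichotomy k k' with h | h | h
      · have := hamono (show k.succ ≤ k'.castSucc from h)
        omega
      · exact h
      · have := hamono (show k'.succ ≤ k.castSucc from h)
        omega
    rfl
  have hind := (hE.iIndepFun_dyadicInc n).precomp hg
  have hprod := hind.integral_fun_prod_comp (f := fun j : J ↦ jumpPhase (θ j.1))
    (fun j ↦ (measurable_dyadicInc hE.measurable n (g j)).aemeasurable)
    (fun j ↦ (measurable_jumpPhase _).aestronglyMeasurable)
  simp only [exp_incSum_dyadicCount n ht]
  rw [Fintype.prod_sigma] at hprod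
  simp only [g] at hprod
  have hcoe (f : Fin K → ℕ → ℂ) :
      ∏ k : Fin K, ∏ l : Finset.Ico (a k.castSucc) (a k.succ), f k l =
      ∏ k : Fin K, ∏ l ∈ Finset.Ico (a k.castSucc) (a k.succ), f k l :=
    Finset.prod_congr rfl fun k _ ↦ Finset.prod_coe_sort _ (f k)
  rw [← hcoe fun k l ↦ ∫ ω, jumpPhase (θ k) (dyadicInc S n l ω) ∂P, ← hprod]
  refine integral_congr_ae (ae_of_all _ fun ω ↦ ?_)
  exact (hcoe fun k l ↦ jumpPhase (θ k) (dyadicInc S n l ω)).symm.trans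
    (Fintype.prod_sigma fun j : J ↦ jumpPhase (θ j.1) (dyadicInc S n j.2 ω)).symm

lemma tendsto_integral_exp_incSum_dyadicCount [IsProbabilityMeasure P]
    (hE : SmallJumpEstimates P I lam S) {K : ℕ} {t : Fin (K + 1) → ℝ≥0} (ht : Monotone t)
    (htd : ∀ k, IsDyadic (t k)) (θ : Fin K → I → ℝ) :
    Tendsto (fun n ↦
      ∫ ω, Complex.exp (incSum (fun i : I ↦ dyadicCount S i n) t θ ω * Complex.I) ∂P) atTop
      (𝓝 (∏ k, Complex.exp (∑ i, ((∫ x in (t k.castSucc : ℝ)..t k.succ, lam i x : ℝ) : ℂ) *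
        (Complex.exp (θ k i * Complex.I) - 1)))) := by
  simp only [hE.integral_exp_incSum_dyadicCount _ ht]
  refine tendsto_finsetProd _ fun k _ ↦ ?_
  have := hE.tendsto_prod_integral_dyadicInc (htd k.castSucc) (htd k.succ)
    (ht (Fin.castSucc_le_succ k)) (measurable_jumpPhase (θ k)) (norm_jumpPhase (θ k))
    (jumpPhase_zero hE.zero_notMem _)
  simpa only [compoundExponent, jumpPhase_coe] using this

end SmallJumpEstimates

lemma measurable_incSum {N : I → ℝ≥0 → Ω → ℕ} (hN : ∀ i t, Measurable (N i t)) {K : ℕ}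
    (t : Fin (K + 1) → ℝ≥0) (θ : Fin K → I → ℝ) : Measurable (incSum N t θ) := by
  have h (i : I) (s : ℝ≥0) : Measurable fun ω ↦ (N i s ω : ℝ) :=
    measurable_from_top.comp (hN i s)
  unfold incSum
  exact Finset.measurable_fun_sum _ fun k _ ↦ Finset.measurable_fun_sum _ fun i _ ↦
    ((h i _).sub (h i _)).const_mul _

/-- Both processes and times may vary with n: this serves for counts at fixed dyadic times, and for
a fixed process along dyadic times decreasing to `t`. -/
lemma tendsto_integral_exp_incSum [IsFiniteMeasure P] {N : ℕ → I → ℝ≥0 → Ω → ℕ}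
    {M : I → ℝ≥0 → Ω → ℕ} (hN : ∀ n i t, Measurable (N n i t)) {K : ℕ}
    (τ : ℕ → Fin (K + 1) → ℝ≥0) (t : Fin (K + 1) → ℝ≥0)
    (h : ∀ i k, ∀ᵐ ω ∂P, ∀ᶠ n in atTop, N n i (τ n k) ω = M i (t k) ω) (θ : Fin K → I → ℝ) :
    Tendsto (fun n ↦ ∫ ω, Complex.exp (incSum (N n) (τ n) θ ω * Complex.I) ∂P) atTop
      (𝓝 (∫ ω, Complex.exp (incSum M t θ ω * Complex.I) ∂P)) := by
  refine tendsto_integral_of_dominated_convergence (fun _ ↦ 1) (fun n ↦ ?_)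
    (integrable_const 1) (fun n ↦ ae_of_all _ fun ω ↦ ?_) ?_
  · have := measurable_incSum (hN n) (τ n) θ
    exact Measurable.aestronglyMeasurable (by fun_prop)
  · rw [Complex.norm_exp_ofReal_mul_I]
  · have h' : ∀ᵐ ω ∂P, ∀ i k, ∀ᶠ n in atTop, N n i (τ n k) ω = M i (t k) ω :=
      ae_all_iff.2 fun i ↦ ae_all_iff.2 fun k ↦ h i k
    filter_upwards [h'] with ω hω
    have hω' : ∀ᶠ n in atTop, ∀ i k, N n i (τ n k) ω = M i (t k) ω :=
      eventually_all.2 fun i ↦ eventually_all.2 fun k ↦ hω i k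
    refine tendsto_const_nhds.congr' ?_
    filter_upwards [hω'] with n hn
    simp only [incSum, hn]

lemma tendsto_real_ne_of_ae_eventually_eq [IsFiniteMeasure P] {β : Type*} {Z : ℕ → Ω → β}
    {W : Ω → β} (hm : ∀ n, MeasurableSet {ω | Z n ω ≠ W ω})
    (h : ∀ᵐ ω ∂P, ∀ᶠ n in atTop, Z n ω = W ω) :
    Tendsto (fun n ↦ P.real {ω | Z n ω ≠ W ω}) atTop (𝓝 0) := by
  have h1 (n : ℕ) : P.real {ω | Z n ω ≠ W ω} =
      ∫ ω, ({ω | Z n ω ≠ W ω}.indicator 1 ω : ℝ) ∂P := (integral_indicator_one (hm n)).symm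
  simp only [h1]
  rw [show (0 : ℝ) = ∫ _, (0 : ℝ) ∂P by simp]
  refine tendsto_integral_of_dominated_convergence (fun _ ↦ 1)
    (fun n ↦ (measurable_one.indicator (hm n)).aestronglyMeasurable)
    (integrable_const 1) (fun n ↦ ae_of_all _ fun ω ↦ ?_) ?_
  · by_cases hω : Z n ω = W ω <;> simp [hω]
  · filter_upwards [h] with ω hω
    refine tendsto_const_nhds.congr' ?_
    filter_upwards [hω] with n hn
    simp [hn]

end JointCharFun

/-! ### Right-continuous counting processes -/

section Construction

variable {Ω : Type*} {mΩ : MeasurableSpace Ω} {P : Measure Ω} {S : ℝ≥0 → Ω → ℝ}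
  {I : Finset ℝ} {lam : I → ℝ → ℝ}

/-- The first multiple of `1 / 2 ^ n` after `t`. -/
noncomputable def nextDyadic (n : ℕ) (t : ℝ≥0) : ℝ≥0 := dyadic n (⌊2 ^ n * t⌋₊ + 1)

lemma lt_nextDyadic (n : ℕ) (t : ℝ≥0) : t < nextDyadic n t := by
  unfold nextDyadic dyadic
  rw [lt_div_iff₀ (by positivity), mul_comm]
  push_cast
  exact Nat.lt_floor_add_one _

lemma nextDyadic_mono (n : ℕ) : Monotone (nextDyadic n) := fun s t h ↦ by
  apply dyadic_mono
  gcongr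

lemma isDyadic_nextDyadic (n : ℕ) (t : ℝ≥0) : IsDyadic (nextDyadic n t) := isDyadic_dyadic _ _

lemma nextDyadic_le (n : ℕ) (t : ℝ≥0) : (nextDyadic n t : ℝ) ≤ t + (1 / 2) ^ n := by
  have h1 := dyadic_succ_sub n ⌊2 ^ n * t⌋₊
  have h2 : (dyadic n ⌊2 ^ n * t⌋₊ : ℝ) ≤ t := dyadic_floor_le n t
  rw [nextDyadic]
  linarith

lemma tendsto_nextDyadic (t : ℝ≥0) : Tendsto (fun n ↦ nextDyadic n t) atTop (𝓝 t) := by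
  rw [← NNReal.tendsto_coe]
  have h1 : Tendsto (fun n : ℕ ↦ (t : ℝ) + (1 / 2) ^ n) atTop (𝓝 (t + 0)) :=
    tendsto_const_nhds.add (tendsto_pow_atTop_nhds_zero_of_lt_one (by norm_num) (by norm_num))
  rw [add_zero] at h1
  exact tendsto_of_tendsto_of_tendsto_of_le_of_le tendsto_const_nhds h1
    (fun n ↦ (lt_nextDyadic n t).le) (fun n ↦ nextDyadic_le n t)

/-- The right-continuous regularization of a function `M` on dyadic times. -/
noncomputable def rightInf (M : ℝ≥0 → Ω → ℕ) (t : ℝ≥0) (ω : Ω) : ℕ :=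
  ⨅ p : {p : ℕ × ℕ // t < dyadic p.1 p.2}, M (dyadic p.1.1 p.1.2) ω

instance (t : ℝ≥0) : Nonempty {p : ℕ × ℕ // t < dyadic p.1 p.2} :=
  ⟨⟨(0, ⌊2 ^ 0 * t⌋₊ + 1), lt_nextDyadic 0 t⟩⟩

lemma measurable_rightInf {M : ℝ≥0 → Ω → ℕ} (hM : ∀ t, Measurable (M t)) (t : ℝ≥0) :
    Measurable (rightInf M t) :=
  Measurable.iInf fun _ ↦ hM _

lemma rightInf_le (M : ℝ≥0 → Ω → ℕ) {s t : ℝ≥0} (hs : IsDyadic s) (hst : t < s) (ω : Ω) :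
    rightInf M t ω ≤ M s ω := by
  obtain ⟨n, k, rfl⟩ := hs
  exact ciInf_le (OrderBot.bddBelow _)
    (⟨(n, k), hst⟩ : {p : ℕ × ℕ // t < dyadic p.1 p.2})

/-- An infimum of natural numbers is attained, here at a dyadic time strictly after t. -/
lemma exists_rightInf_eq (M : ℝ≥0 → Ω → ℕ) (t : ℝ≥0) (ω : Ω) :
    ∃ s, IsDyadic s ∧ t < s ∧ rightInf M t ω = M s ω := by
  obtain ⟨p, hp⟩ := Nat.sInf_mem (Set.range_nonempty
    fun p : {p : ℕ × ℕ // t < dyadic p.1 p.2} ↦ M (dyadic p.1.1 p.1.2) ω)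
  exact ⟨_, isDyadic_dyadic _ _, p.2, hp.symm⟩

lemma monotone_rightInf (M : ℝ≥0 → Ω → ℕ) (ω : Ω) : Monotone fun t ↦ rightInf M t ω := by
  intro s t hst
  obtain ⟨u, hu, htu, h⟩ := exists_rightInf_eq M t ω
  simp only [h]
  exact rightInf_le M hu (hst.trans_lt htu) ω

/-- If the infimum is attained at u > t, the regularization is constant on [t, u). -/
lemma continuousWithinAt_rightInf (M : ℝ≥0 → Ω → ℕ) (ω : Ω) (t : ℝ≥0) :
    ContinuousWithinAt (fun s ↦ rightInf M s ω) (Set.Ici t) t := by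
  obtain ⟨u, hu, htu, h⟩ := exists_rightInf_eq M t ω
  refine tendsto_const_nhds.congr' ?_
  filter_upwards [self_mem_nhdsWithin, mem_nhdsWithin_of_mem_nhds (Iio_mem_nhds htu)] with s hs hsu
  exact le_antisymm (monotone_rightInf M ω hs) (h ▸ rightInf_le M hu hsu ω)

lemma eventually_eq_rightInf {M : ℝ≥0 → Ω → ℕ} {ω : Ω}
    (hM : ∀ s t, IsDyadic s → IsDyadic t → s ≤ t → M s ω ≤ M t ω) (t : ℝ≥0) :
    ∀ᶠ n in atTop, M (nextDyadic n t) ω = rightInf M t ω := by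
  obtain ⟨u, hu, htu, h⟩ := exists_rightInf_eq M t ω
  filter_upwards [(tendsto_nextDyadic t).eventually (Iio_mem_nhds htu)] with n hn
  refine le_antisymm ?_ (rightInf_le M (isDyadic_nextDyadic n t) (lt_nextDyadic n t) ω)
  rw [h]
  exact hM _ _ (isDyadic_nextDyadic n t) hu (le_of_lt hn)

lemma ae_forall_isDyadic {p : ℝ≥0 → Ω → Prop} (h : ∀ t, IsDyadic t → ∀ᵐ ω ∂P, p t ω) :
    ∀ᵐ ω ∂P, ∀ t, IsDyadic t → p t ω := by
  have : ∀ᵐ ω ∂P, ∀ n k, p (dyadic n k) ω :=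
    ae_all_iff.2 fun n ↦ ae_all_iff.2 fun k ↦ h _ (isDyadic_dyadic n k)
  filter_upwards [this] with ω hω
  rintro _ ⟨n, k, rfl⟩
  exact hω n k

namespace SmallJumpEstimates

lemma exists_limit [IsProbabilityMeasure P] (hE : SmallJumpEstimates P I lam S) :
    ∃ M : I → ℝ≥0 → Ω → ℕ, (∀ i t, Measurable (M i t)) ∧
      ∀ (i : I) t, IsDyadic t → ∀ᵐ ω ∂P, ∀ᶠ n in atTop, dyadicCount S i n t ω = M i t ω := by
  have h (i : I) (t : ℝ≥0) : ∃ M : Ω → ℕ, Measurable M ∧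
      (IsDyadic t → ∀ᵐ ω ∂P, ∀ᶠ n in atTop, dyadicCount S i n t ω = M ω) := by
    by_cases ht : IsDyadic t
    · obtain ⟨M, hM, hlim⟩ := measurable_limit_of_tendsto_metrizable_ae (L := atTop) (μ := P)
        (fun n ↦ (measurable_dyadicCount hE.measurable i n t).aemeasurable) (by
          filter_upwards [hE.ae_exists_eventually_eq i ht] with ω ⟨l, hl⟩
          exact ⟨l, tendsto_const_nhds.congr' (hl.mono fun n hn ↦ hn.symm)⟩)
      refine ⟨M, hM, fun _ ↦ ?_⟩
      filter_upwards [hlim] with ω hω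
      -- In ℕ, convergence means eventual equality.
      rwa [nhds_discrete, tendsto_pure] at hω
    -- The value at non-dyadic times is arbitrary: `rightInf` samples only dyadic times.
    · exact ⟨fun _ ↦ 0, measurable_const, fun h ↦ absurd h ht⟩
  choose M hM hlim using h
  exact ⟨M, hM, hlim⟩

variable {M : I → ℝ≥0 → Ω → ℕ}

lemma hasPoissonCharFun_limit [IsProbabilityMeasure P] (hE : SmallJumpEstimates P I lam S)
    (hlim : ∀ (i : I) t, IsDyadic t → ∀ᵐ ω ∂P, ∀ᶠ n in atTop, dyadicCount S i n t ω = M i t ω) :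
    HasPoissonCharFun P lam M {t | IsDyadic t} := by
  intro K t ht htd θ
  refine tendsto_nhds_unique ?_ (hE.tendsto_integral_exp_incSum_dyadicCount ht htd θ)
  exact tendsto_integral_exp_incSum
    (fun n i t ↦ measurable_dyadicCount hE.measurable i n t) (fun _ ↦ t) t
    (fun i k ↦ hlim i _ (htd k)) θ

lemma ae_monotone_limit (hlim : ∀ (i : I) t, IsDyadic t →
      ∀ᵐ ω ∂P, ∀ᶠ n in atTop, dyadicCount S i n t ω = M i t ω) (i : I) :
    ∀ᵐ ω ∂P, ∀ s t, IsDyadic s → IsDyadic t → s ≤ t → M i s ω ≤ M i t ω := by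
  filter_upwards [ae_forall_isDyadic (hlim i)] with ω hω s t hs ht hst
  obtain ⟨n, h1, h2⟩ := ((hω s hs).and (hω t ht)).exists
  rw [← h1, ← h2]
  exact dyadicCount_mono S i n ω hst

/-- The expansion is applied to the indicator of the complement of I ∪ {0}, whose zeroth- and
first-order terms vanish. -/
lemma real_dyadicInc_notMem_le [IsProbabilityMeasure P] (hE : SmallJumpEstimates P I lam S)
    (n k : ℕ) :
    P.real {ω | dyadicInc S n k ω ∉ insert 0 I} ≤ 4 * dyadicMean lam n k ^ 2 := by
  set B : Set ℝ := (↑(insert 0 I) : Set ℝ)ᶜ with hB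
  have hBm : MeasurableSet B := (Finset.measurableSet _).compl
  have h := hE.expansion _ _ (dyadic_mono n (Nat.le_succ k)) (B.indicator 1)
    (measurable_one.indicator hBm) fun x ↦ by
      by_cases hx : x ∈ B <;> simp [hx]
  have hm : MeasurableSet {ω | dyadicInc S n k ω ∉ insert 0 I} :=
    measurable_dyadicInc hE.measurable n k hBm
  have h0 : B.indicator (1 : ℝ → ℂ) 0 = 0 := by simp [hB]
  have hi (i : I) : B.indicator (1 : ℝ → ℂ) i = 0 := by simp [hB]
  simp only [h0, hi, sub_zero, mul_zero, Finset.sum_const_zero] at h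
  have h1 : ∫ ω, B.indicator (1 : ℝ → ℂ) (S (dyadic n k.succ) ω - S (dyadic n k) ω) ∂P =
      (P.real {ω | dyadicInc S n k ω ∉ insert 0 I} : ℂ) := by
    rw [← integral_indicator_one hm, ← integral_complex_ofReal]
    refine integral_congr_ae (ae_of_all _ fun ω ↦ ?_)
    simp only [Set.indicator_apply, Pi.one_apply, Set.mem_ofPred_eq, hB, Set.mem_compl_iff,
      SetLike.mem_coe, dyadicInc]
    split_ifs <;> simp
  rw [h1, Complex.norm_real, Real.norm_of_nonneg measureReal_nonneg] at h
  exact h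

lemma sub_eq_sum_dyadicCount (hI : (0 : ℝ) ∉ I) {n a : ℕ} {ω : Ω}
    (h : ∀ k ∈ Finset.range a, dyadicInc S n k ω ∈ insert 0 I) :
    S (dyadic n a) ω - S 0 ω = ∑ i : I, (i : ℝ) * (dyadicCount S i n (dyadic n a) ω : ℝ) := by
  have h1 : S (dyadic n a) ω - S 0 ω = ∑ k ∈ Finset.range a, dyadicInc S n k ω := by
    rw [← dyadic_zero n]
    exact (Finset.sum_range_sub (fun k ↦ S (dyadic n k) ω) a).symm
  simp only [dyadicCount, floor_dyadic]
  push_cast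
  simp only [Finset.mul_sum]
  rw [h1, Finset.sum_comm]
  refine Finset.sum_congr rfl fun k hk ↦ ?_
  rcases Finset.mem_insert.1 (h k hk) with h0 | hmem
  · have : ∀ i : I, (0 : ℝ) ≠ i := fun i h ↦ hI (h ▸ i.2)
    simp [h0, this]
  · have : ∀ i : I, (dyadicInc S n k ω = i) ↔ (⟨dyadicInc S n k ω, hmem⟩ : I) = i :=
      fun i ↦ by rw [Subtype.ext_iff]
    simp [this]

lemma eq_sum_limit [IsProbabilityMeasure P] (hE : SmallJumpEstimates P I lam S)
    (hM : ∀ i t, Measurable (M i t))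
    (hlim : ∀ (i : I) t, IsDyadic t → ∀ᵐ ω ∂P, ∀ᶠ n in atTop, dyadicCount S i n t ω = M i t ω)
    {t : ℝ≥0} (ht : IsDyadic t) :
    ∀ᵐ ω ∂P, S t ω = ∑ i : I, (i : ℝ) * (M i t ω : ℝ) := by
  have hM' (i : I) : Measurable fun ω ↦ (M i t ω : ℝ) := measurable_from_top.comp (hM i t)
  have hne (i : I) := tendsto_real_ne_of_ae_eventually_eq (P := P)
    (Z := fun n ↦ dyadicCount S i n t) (W := M i t)
    (fun n ↦ (measurableSet_eq_fun (measurable_dyadicCount hE.measurable i n t) (hM i t)).compl)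
    (hlim i t ht)
  have hto : Tendsto (fun n ↦ 4 * sqMean lam n ⌊2 ^ n * t⌋₊ +
      ∑ i : I, P.real {ω | dyadicCount S i n t ω ≠ M i t ω}) atTop (𝓝 (4 * 0 + ∑ _i : I, 0)) :=
    ((hE.tendsto_sqMean t).const_mul 4).add (tendsto_finsetSum _ fun i _ ↦ hne i)
  simp only [mul_zero, Finset.sum_const_zero, add_zero] at hto
  -- At level n the identity is exact unless some increment leaves I ∪ {0} or some count differs
  -- from its limit. Both probabilities tend to 0, whereas the event on the left does not depend on
  -- n.
  have hle : P.real {ω | ¬ S t ω - S 0 ω = ∑ i : I, (i : ℝ) * (M i t ω : ℝ)} ≤ 0 := by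
    refine ge_of_tendsto hto ?_
    filter_upwards [ht.eventually] with n hn
    set a := ⌊2 ^ n * t⌋₊
    calc _ ≤ P.real ((⋃ k ∈ Finset.range a, {ω | dyadicInc S n k ω ∉ insert 0 I}) ∪
          ⋃ i ∈ (Finset.univ : Finset I), {ω | dyadicCount S i n t ω ≠ M i t ω}) := by
          refine measureReal_mono (fun ω hω ↦ ?_) (measure_ne_top _ _)
          by_contra hcon
          simp only [Set.mem_union, Set.mem_iUnion, not_or, not_exists, Set.mem_ofPred_eq,
            not_not, exists_prop, not_and] at hcon
          have h1 := sub_eq_sum_dyadicCount hE.zero_notMem hcon.1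
          rw [← hn] at h1
          refine hω (h1.trans (Finset.sum_congr rfl fun i hi ↦ ?_))
          rw [hcon.2 i hi]
      _ ≤ _ := (measureReal_union_le _ _).trans (add_le_add
          ((measureReal_biUnion_finset_le _ _).trans ?_) (measureReal_biUnion_finset_le _ _))
    rw [sqMean, Finset.mul_sum]
    exact Finset.sum_le_sum fun k _ ↦ hE.real_dyadicInc_notMem_le n k
  have h0 : P {ω | ¬ S t ω - S 0 ω = ∑ i : I, (i : ℝ) * (M i t ω : ℝ)} = 0 :=
    (measureReal_eq_zero_iff (measure_ne_top _ _)).1 (le_antisymm hle measureReal_nonneg)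
  filter_upwards [ae_iff.2 h0, hE.zero_ae] with ω h1 h2
  rw [← h1, h2, sub_zero]

/-- A nonzero count needs a nonzero increment. Letting t decrease to 0 will give N_i(0) = 0. -/
lemma real_limit_ne_zero_le [IsProbabilityMeasure P] (hE : SmallJumpEstimates P I lam S)
    (hM : ∀ i t, Measurable (M i t))
    (hlim : ∀ (i : I) t, IsDyadic t → ∀ᵐ ω ∂P, ∀ᶠ n in atTop, dyadicCount S i n t ω = M i t ω)
    (i : I) {t : ℝ≥0} (ht : IsDyadic t) : P.real {ω | M i t ω ≠ 0} ≤ jumpMean lam 0 t := by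
  have hi : (i : ℝ) ≠ 0 := fun h ↦ hE.zero_notMem (h ▸ i.2)
  have hne := tendsto_real_ne_of_ae_eventually_eq (P := P)
    (Z := fun n ↦ dyadicCount S i n t) (W := M i t)
    (fun n ↦ (measurableSet_eq_fun (measurable_dyadicCount hE.measurable i n t) (hM i t)).compl)
    (hlim i t ht)
  have hto := hne.add_const (jumpMean lam 0 t)
  rw [zero_add] at hto
  refine ge_of_tendsto hto ?_
  filter_upwards [ht.eventually] with n hn
  have h1 : P.real {ω | dyadicCount S i n t ω ≠ 0} ≤ jumpMean lam 0 t := by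
    calc _ ≤ P.real (⋃ k ∈ Finset.range ⌊2 ^ n * t⌋₊, {ω | dyadicInc S n k ω ≠ 0}) := by
          refine measureReal_mono (fun ω hω ↦ ?_) (measure_ne_top _ _)
          by_contra hcon
          simp only [Set.mem_iUnion, exists_prop, not_exists, not_and, Set.mem_ofPred_eq,
            not_not] at hcon
          refine hω (Finset.sum_eq_zero fun k hk ↦ ?_)
          rw [if_neg]
          rw [hcon k hk]
          exact hi.symm
      _ ≤ ∑ k ∈ Finset.range ⌊2 ^ n * t⌋₊, dyadicMean lam n k :=
          (measureReal_biUnion_finset_le _ _).trans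
            (Finset.sum_le_sum fun k _ ↦ hE.real_dyadicInc_ne_le n k)
      _ = jumpMean lam 0 t := by rw [hE.sum_dyadicMean, ← hn]
  calc _ ≤ P.real ({ω | dyadicCount S i n t ω ≠ M i t ω} ∪ {ω | dyadicCount S i n t ω ≠ 0}) := by
        refine measureReal_mono (fun ω hω ↦ ?_) (measure_ne_top _ _)
        by_cases h : dyadicCount S i n t ω = M i t ω
        · exact Or.inr (by simpa [h] using hω)
        · exact Or.inl h
    _ ≤ _ := (measureReal_union_le _ _).trans (by gcongr)

lemma _root_.Skellam.tendsto_integral_rate_nextDyadic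
    (lam_integrable : ∀ (i : I) (t : ℝ), 0 ≤ t → IntegrableOn (lam i) (Set.Icc 0 t) volume)
    (i : I) (s t : ℝ≥0) :
    Tendsto (fun n ↦ ∫ x in (nextDyadic n s : ℝ)..nextDyadic n t, lam i x) atTop
      (𝓝 (∫ x in (s : ℝ)..t, lam i x)) := by
  have h1 (u : ℝ≥0) : Tendsto (fun n ↦ ∫ x in (0 : ℝ)..nextDyadic n u, lam i x) atTop
      (𝓝 (∫ x in (0 : ℝ)..u, lam i x)) := by
    have hu : (0 : ℝ) ≤ u + 1 := by positivity
    have hc : ContinuousOn (fun v ↦ ∫ x in (0 : ℝ)..v, lam i x) (Set.Icc 0 (u + 1)) := by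
      rw [← Set.uIcc_of_le hu]
      exact intervalIntegral.continuousOn_primitive_interval
        (by rw [Set.uIcc_of_le hu]; exact lam_integrable i _ hu)
    refine (hc u ⟨u.coe_nonneg, by linarith⟩).tendsto.comp
      (tendsto_nhdsWithin_of_tendsto_nhds_of_eventually_within _
        (NNReal.tendsto_coe.2 (tendsto_nextDyadic u)) (Eventually.of_forall fun n ↦
          ⟨NNReal.coe_nonneg _, (nextDyadic_le n u).trans ?_⟩))
    gcongr
    exact pow_le_one₀ (by norm_num) (by norm_num)
  refine ((h1 t).sub (h1 s)).congr' (Eventually.of_forall fun n ↦ ?_) |>.trans (le_of_eq ?_)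
  · exact intervalIntegral.integral_interval_sub_left
      (intervalIntegrable_rate lam_integrable i le_rfl (NNReal.coe_nonneg _))
      (intervalIntegrable_rate lam_integrable i le_rfl (NNReal.coe_nonneg _))
  · rw [intervalIntegral.integral_interval_sub_left
      (intervalIntegrable_rate lam_integrable i le_rfl (NNReal.coe_nonneg _))
      (intervalIntegrable_rate lam_integrable i le_rfl (NNReal.coe_nonneg _))]

/-- The counting processes of the jumps of `S`. -/
theorem exists_counting_processes [IsProbabilityMeasure P]
    (hE : SmallJumpEstimates P I lam S) :
    ∃ N : I → ℝ≥0 → Ω → ℕ, (∀ i t, Measurable (N i t)) ∧ (∀ i, ∀ᵐ ω ∂P, N i 0 ω = 0) ∧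
      (∀ i ω, Monotone (fun t ↦ N i t ω)) ∧
      (∀ i ω t, ContinuousWithinAt (fun s ↦ N i s ω) (Set.Ici t) t) ∧
      HasPoissonCharFun P lam N Set.univ ∧
      ∀ t, ∀ᵐ ω ∂P, S t ω = ∑ i : I, (i : ℝ) * (N i t ω : ℝ) := by
  obtain ⟨M, hM, hlim⟩ := hE.exists_limit
  have hmono (i : I) := ae_monotone_limit hlim i
  have hev (i : I) (t : ℝ≥0) :
      ∀ᵐ ω ∂P, ∀ᶠ n in atTop, M i (nextDyadic n t) ω = rightInf (M i) t ω := by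
    filter_upwards [hmono i] with ω hω using eventually_eq_rightInf hω t
  have hNm (i : I) (t : ℝ≥0) : Measurable (rightInf (M i) t) := measurable_rightInf (hM i) t
  refine ⟨fun i ↦ rightInf (M i), hNm, fun i ↦ ?_, fun i ω ↦ monotone_rightInf (M i) ω,
    fun i ω t ↦ continuousWithinAt_rightInf (M i) ω t, fun K t ht _ θ ↦ ?_, fun t ↦ ?_⟩
  · have h1 := tendsto_real_ne_of_ae_eventually_eq
      (fun n ↦ (measurableSet_eq_fun (hM i (nextDyadic n 0)) (hNm i 0)).compl) (hev i 0)
    have h2 : Tendsto (fun n ↦ jumpMean lam 0 (nextDyadic n 0)) atTop (𝓝 0) := by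
      have hc := (continuousOn_jumpMean hE.rate_integrable zero_le_one) 0 (by simp)
      have := hc.tendsto.comp (tendsto_nhdsWithin_of_tendsto_nhds_of_eventually_within
        (fun n ↦ (nextDyadic n 0 : ℝ)) (NNReal.tendsto_coe.2 (tendsto_nextDyadic 0))
        (Eventually.of_forall fun n ↦ ⟨NNReal.coe_nonneg _, (nextDyadic_le n 0).trans (by
          simpa using pow_le_one₀ (a := (2⁻¹ : ℝ)) (n := n) (by norm_num) (by norm_num))⟩))
      have h0 : jumpMean lam 0 0 = 0 := by simp [jumpMean]
      simpa only [h0] using! this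
    have hle : P.real {ω | ¬ rightInf (M i) 0 ω = 0} ≤ 0 := by
      have h3 := h1.add h2
      rw [add_zero] at h3
      refine ge_of_tendsto' h3 fun n ↦ ?_
      calc _ ≤ P.real ({ω | M i (nextDyadic n 0) ω ≠ rightInf (M i) 0 ω} ∪
            {ω | M i (nextDyadic n 0) ω ≠ 0}) := by
            refine measureReal_mono (fun ω hω ↦ ?_) (measure_ne_top _ _)
            by_cases h : M i (nextDyadic n 0) ω = rightInf (M i) 0 ω
            · exact Or.inr (by simpa [h] using hω)
            · exact Or.inl h
        _ ≤ _ := (measureReal_union_le _ _).trans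
            (by gcongr; exact hE.real_limit_ne_zero_le hM hlim i (isDyadic_nextDyadic n 0))
    exact ae_iff.2 ((measureReal_eq_zero_iff (measure_ne_top _ _)).1
      (le_antisymm hle measureReal_nonneg))
  · have h1 := tendsto_integral_exp_incSum (P := P) (N := fun _ ↦ M)
      (M := fun i ↦ rightInf (M i)) (fun _ ↦ hM) (fun n k ↦ nextDyadic n (t k)) t
      (fun i k ↦ hev i (t k)) θ
    have h2 (n : ℕ) := hE.hasPoissonCharFun_limit hlim K (fun k ↦ nextDyadic n (t k))
      ((nextDyadic_mono n).comp ht) (fun k ↦ isDyadic_nextDyadic n (t k)) θ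
    simp only [h2] at h1
    refine tendsto_nhds_unique h1 (tendsto_finsetProd _ fun k _ ↦ ?_)
    refine (Complex.continuous_exp.tendsto _).comp (tendsto_finsetSum _ fun i _ ↦ ?_)
    exact ((Complex.continuous_ofReal.tendsto _).comp
      (tendsto_integral_rate_nextDyadic hE.rate_integrable i _ _)).mul_const _
  -- S along dyadic times decreasing to t converges to S(t) by continuity in probability and to ∑ i
  -- N_i(t) almost surely; limits in probability are unique.
  · have h1 : TendstoInMeasure P (fun n ↦ S (nextDyadic n t)) atTop (S t) :=
      (hE.stoch_continuous t).comp (tendsto_nextDyadic t)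
    have h2 : TendstoInMeasure P (fun n ↦ S (nextDyadic n t)) atTop
        (fun ω ↦ ∑ i : I, (i : ℝ) * (rightInf (M i) t ω : ℝ)) := by
      refine tendstoInMeasure_of_tendsto_ae
        (fun n ↦ (hE.measurable _).aestronglyMeasurable) ?_
      have h3 : ∀ᵐ ω ∂P, ∀ n, S (nextDyadic n t) ω =
          ∑ i : I, (i : ℝ) * (M i (nextDyadic n t) ω : ℝ) :=
        ae_all_iff.2 fun n ↦ hE.eq_sum_limit hM hlim (isDyadic_nextDyadic n t)
      filter_upwards [h3, ae_all_iff.2 fun i ↦ hev i t] with ω hω1 hω2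
      refine tendsto_const_nhds.congr' ?_
      filter_upwards [eventually_all.2 hω2] with n hn
      rw [hω1 n]
      simp only [hn]
    exact tendstoInMeasure_ae_unique h1 h2

end SmallJumpEstimates

end Construction

/-! ### From characteristic functions to independent Poisson processes -/

section Structure

variable {Ω : Type*} {mΩ : MeasurableSpace Ω} {P : Measure Ω}

/-- Independent random variables indexed by pairs, grouped by the first component, form
independent random vectors. -/
lemma iIndepFun_curry {ι κ E : Type*} [MeasurableSpace E] {Y : ι × κ → Ω → E}
    (hY : ∀ p, Measurable (Y p)) (h : iIndepFun Y P) :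
    iIndepFun (fun i ω k ↦ Y (i, k) ω) P := by
  have := h.isProbabilityMeasure
  have (i : ι) (k : κ) : IsProbabilityMeasure (P.map (Y (i, k))) :=
    Measure.isProbabilityMeasure_map (hY _).aemeasurable
  have hsig : iIndepFun (fun (p : (_ : ι) × κ) ω ↦ Y (p.1, p.2) ω) P :=
    h.precomp (Equiv.sigmaEquivProd ι κ).injective
  have hsub (i : ι) : iIndepFun (fun k ω ↦ Y (i, k) ω) P :=
    h.precomp (g := fun k ↦ (i, k)) (Prod.mk_right_injective i)
  have hcomp : (MeasurableEquiv.piCurry fun (_ : ι) (_ : κ) ↦ E) ∘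
      (fun ω (p : (_ : ι) × κ) ↦ Y (p.1, p.2) ω) = fun ω i k ↦ Y (i, k) ω := by
    ext
    simp [Sigma.curry]
  rw [iIndepFun_iff_map_fun_eq_infinitePi_map (by fun_prop), ← hcomp,
    ← Measure.map_map (by fun_prop) (by fun_prop),
    (iIndepFun_iff_map_fun_eq_infinitePi_map (by fun_prop)).1 hsig,
    Measure.infinitePi_map_piCurry (fun i k ↦ P.map (Y (i, k)))]
  congrm Measure.infinitePi fun i ↦ ?_
  rw [← (iIndepFun_iff_map_fun_eq_infinitePi_map (by fun_prop)).1 (hsub i)]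

lemma sum_ite_castSucc_lt {K : ℕ} (f : Fin (K + 1) → ℝ) (m : Fin (K + 1)) :
    ∑ k : Fin K, (if k.castSucc < m then f k.succ - f k.castSucc else 0) = f m - f 0 := by
  induction m using Fin.induction with
  | zero => simp
  | succ m ih =>
    have h (k : Fin K) : (if k.castSucc < m.succ then f k.succ - f k.castSucc else 0) =
        (if k.castSucc < m.castSucc then f k.succ - f k.castSucc else 0) +
          if k = m then f k.succ - f k.castSucc else 0 := by
      rcases lt_trichotomy k m with h | rfl | h
      · simp [h, h.ne, Fin.castSucc_lt_succ_iff, h.le]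
      · simp
      · simp [h.ne', Fin.castSucc_lt_succ_iff, not_le.2 h, not_lt.2 h.le]
    simp only [h, Finset.sum_add_distrib, ih]
    simp

variable {I : Finset ℝ} {lam : I → ℝ → ℝ} {N : I → ℝ≥0 → Ω → ℕ}

/-- The increment of `N i` over the `k`-th interval of a subdivision. -/
noncomputable def subdivInc (N : I → ℝ≥0 → Ω → ℕ) {K : ℕ} (t : Fin (K + 1) → ℝ≥0)
    (p : I × Fin K) (ω : Ω) : ℝ :=
  (N p.1 (t p.2.succ) ω : ℝ) - N p.1 (t p.2.castSucc) ω

lemma measurable_natCast_comp {f : Ω → ℕ} (hf : Measurable f) : Measurable fun ω ↦ (f ω : ℝ) :=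
  measurable_from_top.comp hf

lemma measurable_subdivInc (hN : ∀ i t, Measurable (N i t)) {K : ℕ} (t : Fin (K + 1) → ℝ≥0)
    (p : I × Fin K) : Measurable (subdivInc N t p) :=
  (measurable_natCast_comp (hN _ _)).sub (measurable_natCast_comp (hN _ _))

namespace HasPoissonCharFun

lemma charFun_increment (hN : ∀ i t, Measurable (N i t))
    (h : HasPoissonCharFun P lam N Set.univ) (i : I) {s t : ℝ≥0} (hst : s ≤ t) (u : ℝ) :
    charFun (P.map fun ω ↦ (N i t ω : ℝ) - N i s ω) u =
      Complex.exp (((∫ x in (s : ℝ)..t, lam i x : ℝ) : ℂ) *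
        (Complex.exp (u * Complex.I) - 1)) := by
  classical
  have hm : Measurable fun ω ↦ (N i t ω : ℝ) - N i s ω :=
    (measurable_natCast_comp (hN i t)).sub (measurable_natCast_comp (hN i s))
  have hmono : Monotone ![s, t] := by
    rw [Fin.monotone_iff_le_succ]
    intro k
    fin_cases k
    exact hst
  have h1 := h 1 ![s, t] hmono (fun _ ↦ Set.mem_univ _) (fun _ ↦ Pi.single i u)
  rw [charFun_apply, integral_map hm.aemeasurable (by fun_prop)]
  convert! h1 using 2
  · ext ω
    congr 2
    rw [incSum]
    simp only [Fin.sum_univ_one]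
    rw [Finset.sum_eq_single i]
    · simp
    · intro j _ hj
      simp [hj]
    · simp
  · simp only [Fin.prod_univ_one]
    congr 1
    rw [Finset.sum_eq_single i]
    · simp
    · intro j _ hj
      simp [hj]
    · simp

lemma hasLaw_increment [IsProbabilityMeasure P] (hN : ∀ i t, Measurable (N i t))
    (lam_nonneg : ∀ (i : I) (t : ℝ), 0 ≤ t → 0 ≤ lam i t)
    (h : HasPoissonCharFun P lam N Set.univ) (i : I) {s t : ℝ≥0} (hst : s ≤ t) :
    HasLaw (fun ω ↦ (N i t ω : ℝ) - (N i s ω : ℝ))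
      ((poissonMeasure (Real.toNNReal (∫ x in (s : ℝ)..(t : ℝ), lam i x))).map
        (Nat.cast : ℕ → ℝ)) P := by
  have hm : Measurable fun ω ↦ (N i t ω : ℝ) - N i s ω :=
    (measurable_natCast_comp (hN i t)).sub (measurable_natCast_comp (hN i s))
  refine ⟨hm.aemeasurable, ?_⟩
  have := Measure.isProbabilityMeasure_map (μ := P) hm.aemeasurable
  refine Measure.ext_of_charFun (funext fun u ↦ ?_)
  rw [h.charFun_increment hN i hst, charFun_map_cast_poissonMeasure]
  congr 2
  exact congrArg (fun x : ℝ ↦ (x : ℂ)) (Real.coe_toNNReal _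
    (integral_rate_nonneg lam_nonneg i s.coe_nonneg hst)).symm

/-- The joint characteristic function factorises over all pairs (i, k), so the increments are
independent across processes and intervals simultaneously. -/
lemma iIndepFun_subdivInc [IsProbabilityMeasure P] (hN : ∀ i t, Measurable (N i t))
    (h : HasPoissonCharFun P lam N Set.univ) {K : ℕ} {t : Fin (K + 1) → ℝ≥0} (ht : Monotone t) :
    iIndepFun (subdivInc N t) P := by
  have hm := measurable_subdivInc hN t
  rw [iIndepFun_iff_charFun_pi fun p ↦ (hm p).aemeasurable]
  intro v
  rw [charFun_apply, integral_map (by fun_prop) (by fun_prop)]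
  have h1 := h K t ht (fun _ ↦ Set.mem_univ _) (fun k i ↦ v (i, k))
  have h2 (p : I × Fin K) : charFun (P.map (subdivInc N t p)) (v p) =
      Complex.exp (((∫ x in (t p.2.castSucc : ℝ)..t p.2.succ, lam p.1 x : ℝ) : ℂ) *
        (Complex.exp (v p * Complex.I) - 1)) :=
    h.charFun_increment hN p.1 (ht (Fin.castSucc_le_succ _)) (v p)
  simp only [h2]
  rw [Fintype.prod_prod_type_right]
  simp only [← Complex.exp_sum]
  simp only [← Complex.exp_sum] at h1
  rw [← h1]
  congr with ω
  rw [incSum, PiLp.inner_apply, Fintype.sum_prod_type_right]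
  simp [subdivInc]

theorem isIndepPoissonFamily [IsProbabilityMeasure P] (hN : ∀ i t, Measurable (N i t))
    (lam_nonneg : ∀ (i : I) (t : ℝ), 0 ≤ t → 0 ≤ lam i t)
    (h : HasPoissonCharFun P lam N Set.univ) (h0 : ∀ i, ∀ᵐ ω ∂P, N i 0 ω = 0)
    (hmono : ∀ i ω, Monotone (fun t ↦ N i t ω))
    (hcont : ∀ i ω t, ContinuousWithinAt (fun s ↦ N i s ω) (Set.Ici t) t) :
    IsIndepPoissonFamily P I lam N where
  poisson i :=
    { measurable := hN i
      zero := h0 i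
      paths := ae_of_all _ fun ω ↦ ⟨hmono i ω, hcont i ω⟩
      indep_increments := fun K t ht ↦
        (h.iIndepFun_subdivInc hN ht).precomp (g := fun k ↦ (i, k)) (Prod.mk_right_injective i)
      law_increments := fun s t hst ↦ h.hasLaw_increment hN lam_nonneg i hst }
  indep := by
    refine iIndepFun.iIndepFun_process hN fun A J ↦ ?_
    -- All processes are put on one common subdivision. It starts at 0, so that each value is a sum
    -- of increments from N_i(0) = 0.
    set U : Finset ℝ≥0 := insert 0 (Finset.univ.biUnion J) with hU
    obtain ⟨K, hK⟩ : ∃ K, U.card = K + 1 :=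
      Nat.exists_eq_succ_of_ne_zero (Finset.card_ne_zero_of_mem (Finset.mem_insert_self 0 _))
    set t : Fin (K + 1) → ℝ≥0 := ⇑(U.orderEmbOfFin hK) with ht
    have htm : Monotone t := (U.orderEmbOfFin hK).monotone
    have hmem (u : ℝ≥0) (hu : u ∈ U) : ∃ m, t m = u := by
      have := Finset.range_orderEmbOfFin U hK
      have hu' : u ∈ Set.range (U.orderEmbOfFin hK) := by rw [this]; exact hu
      exact hu'
    have ht0 : t 0 = 0 := by
      obtain ⟨m, hm⟩ := hmem 0 (Finset.mem_insert_self 0 _)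
      exact le_antisymm ((htm (Fin.zero_le m)).trans hm.le) zero_le
    have hJ (i : A) (j : J i) : ∃ m, t m = j :=
      hmem j (Finset.mem_insert_of_mem (Finset.mem_biUnion.2 ⟨i, Finset.mem_univ _, j.2⟩))
    choose m hm using hJ
    have hind := (iIndepFun_curry (measurable_subdivInc hN t)
      (h.iIndepFun_subdivInc hN htm)).precomp (g := ((↑) : A → I)) Subtype.val_injective
    -- The floor converts the real sum of increments back to a natural number. It recovers N_i only
    -- almost surely, since N_i(0) = 0 only almost surely.
    let g (i : A) (y : Fin K → ℝ) (j : J i) : ℕ :=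
      ⌊∑ k : Fin K, if k.castSucc < m i j then y k else 0⌋₊
    have hg (i : A) : Measurable (g i) := by
      refine measurable_pi_lambda _ fun j ↦ Nat.measurable_floor.comp ?_
      refine Finset.measurable_fun_sum _ fun k _ ↦ ?_
      split_ifs
      · exact measurable_pi_apply k
      · exact measurable_const
    refine (hind.comp g hg).congr fun i ↦ ?_
    filter_upwards [h0 i] with ω hω
    ext j
    simp only [Function.comp_apply, g, subdivInc]
    rw [sum_ite_castSucc_lt (fun k ↦ (N i (t k) ω : ℝ)), ht0, hω, hm]
    simp

end HasPoissonCharFun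

/-- The infinitesimal description implies the representation by Poisson processes. -/
theorem IsInfinitesimalSkellam.isPoissonCombination [IsProbabilityMeasure P] {S : ℝ≥0 → Ω → ℝ}
    (hI : (0 : ℝ) ∉ I) (lam_nonneg : ∀ (i : I) (t : ℝ), 0 ≤ t → 0 ≤ lam i t)
    (lam_integrable : ∀ (i : I) (t : ℝ), 0 ≤ t → IntegrableOn (lam i) (Set.Icc 0 t) volume)
    (S_measurable : ∀ t, Measurable (S t)) (S_zero : ∀ᵐ ω ∂P, S 0 ω = 0)
    (hS : IsInfinitesimalSkellam P I lam S) : IsPoissonCombination P I lam S := by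
  obtain ⟨N, hN, h0, hmono, hcont, hchar, hsum⟩ := (hS.smallJumpEstimates hI lam_nonneg
    lam_integrable S_measurable S_zero).exists_counting_processes
  exact ⟨N, hchar.isIndepPoissonFamily hN lam_nonneg h0 hmono hcont, hsum⟩

end Structure

/-! ### From Poisson processes to infinitesimal jumps, generating function and paths -/

section Converse

variable {Ω : Type*} {mΩ : MeasurableSpace Ω} {P : Measure Ω}
  {I : Finset ℝ} {lam : I → ℝ → ℝ} {N : I → ℝ≥0 → Ω → ℕ} {S : ℝ≥0 → Ω → ℝ}

lemma IsPoissonProcess.real_increment_eq {r : ℝ → ℝ} {M : ℝ≥0 → Ω → ℕ}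
    (hM : IsPoissonProcess P r M) {s t : ℝ≥0} (hst : s ≤ t)
    (h0 : 0 ≤ ∫ x in (s : ℝ)..t, r x) (n : ℕ) :
    P.real {ω | (M t ω : ℝ) - M s ω = n} =
      Real.exp (-∫ x in (s : ℝ)..t, r x) * (∫ x in (s : ℝ)..t, r x) ^ n / n.factorial := by
  have h1 := (hM.law_increments s t hst).map_eq
  have hm : Measurable fun ω ↦ (M t ω : ℝ) - M s ω :=
    (measurable_natCast_comp (hM.measurable t)).sub (measurable_natCast_comp (hM.measurable s))
  have h2 : {ω | (M t ω : ℝ) - M s ω = n} = (fun ω ↦ (M t ω : ℝ) - M s ω) ⁻¹' {(n : ℝ)} := rfl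
  have h3 : (Nat.cast : ℕ → ℝ) ⁻¹' {(n : ℝ)} = {n} := by
    ext k
    simp
  rw [h2, ← map_measureReal_apply hm (measurableSet_singleton _), h1,
    map_measureReal_apply measurable_from_top (measurableSet_singleton _), h3,
    poissonMeasure_real_singleton, Real.coe_toNNReal _ h0]

/-- Follows from exp m ≥ 1 + m and (1 - m + m²)(1 + m) = 1 + m³ ≥ 1. -/
lemma exp_neg_le_one_sub_add_sq {m : ℝ} (hm : 0 ≤ m) : Real.exp (-m) ≤ 1 - m + m ^ 2 := by
  rw [Real.exp_neg, inv_le_comm₀ (Real.exp_pos _) (by nlinarith [sq_nonneg (m - 1)])]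
  refine le_trans ?_ (Real.add_one_le_exp m)
  rw [inv_le_comm₀ (by nlinarith [sq_nonneg (m - 1)]) (by linarith), ← one_div,
    div_le_iff₀ (by linarith)]
  nlinarith [pow_nonneg hm 3]

namespace IsIndepPoissonFamily

lemma iIndepFun_increment (hN : IsIndepPoissonFamily P I lam N) (s t : ℝ≥0) :
    iIndepFun (fun (i : I) ω ↦ (N i t ω : ℝ) - N i s ω) P :=
  hN.indep.comp (fun _ f ↦ (f t : ℝ) - f s) fun _ ↦
    (measurable_natCast_comp (measurable_pi_apply t)).sub
      (measurable_natCast_comp (measurable_pi_apply s))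

lemma measurable_increment (hN : IsIndepPoissonFamily P I lam N) (s t : ℝ≥0) (i : I) :
    Measurable fun ω ↦ (N i t ω : ℝ) - N i s ω :=
  (measurable_natCast_comp ((hN.poisson i).measurable t)).sub
    (measurable_natCast_comp ((hN.poisson i).measurable s))

lemma iIndepFun_subdivInc [IsProbabilityMeasure P] (hN : IsIndepPoissonFamily P I lam N) {K : ℕ}
    {t : Fin (K + 1) → ℝ≥0} (ht : Monotone t) : iIndepFun (subdivInc N t) P := by
  refine iIndepFun_uncurry' (X := fun i k ↦ subdivInc N t (i, k))
    (fun i k ↦ hN.measurable_increment _ _ i) ?_ fun i ↦ (hN.poisson i).indep_increments K t ht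
  refine hN.indep.comp (fun (_ : I) (f : ℝ≥0 → ℕ) (k : Fin K) ↦
    (f (t k.succ) : ℝ) - f (t k.castSucc)) fun _ ↦ ?_
  exact measurable_pi_lambda _ fun k ↦
    (measurable_natCast_comp (measurable_pi_apply _)).sub
      (measurable_natCast_comp (measurable_pi_apply _))

lemma hasIndepIncrements [IsProbabilityMeasure P] (hN : IsIndepPoissonFamily P I lam N)
    (hsum : ∀ t, ∀ᵐ ω ∂P, S t ω = ∑ i : I, (i : ℝ) * (N i t ω : ℝ)) :
    HasIndepIncrements S P := by
  intro K t ht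
  have h1 : iIndepFun (fun (p : Fin K × I) ↦ subdivInc N t p.swap) P :=
    (hN.iIndepFun_subdivInc ht).precomp Prod.swap_injective
  have h2 := iIndepFun_curry
    (fun p ↦ measurable_subdivInc (fun i ↦ (hN.poisson i).measurable) t p.swap) h1
  have h3 := h2.comp (fun _ y ↦ ∑ i : I, (i : ℝ) * y i) fun _ ↦ by fun_prop
  refine h3.congr fun k ↦ ?_
  filter_upwards [hsum (t k.succ), hsum (t k.castSucc)] with ω h4 h5
  simp only [Function.comp_apply, subdivInc, Prod.swap_prod_mk]
  rw [h4, h5, ← Finset.sum_sub_distrib]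
  exact Finset.sum_congr rfl fun i _ ↦ mul_sub _ _ _

lemma real_forall_increment_eq [IsProbabilityMeasure P] (hN : IsIndepPoissonFamily P I lam N)
    (lam_nonneg : ∀ (i : I) (t : ℝ), 0 ≤ t → 0 ≤ lam i t) {s t : ℝ≥0} (hst : s ≤ t)
    (n : I → ℕ) :
    P.real {ω | ∀ i, (N i t ω : ℝ) - N i s ω = n i} =
      Real.exp (-jumpMean lam s t) *
        ∏ i, ((∫ x in (s : ℝ)..t, lam i x) ^ n i / (n i).factorial) := by
  have h1 := (hN.iIndepFun_increment s t).meas_iInter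
    (s := fun i ↦ (fun ω ↦ (N i t ω : ℝ) - N i s ω) ⁻¹' {(n i : ℝ)})
    fun i ↦ ⟨{(n i : ℝ)}, measurableSet_singleton _, rfl⟩
  have h2 : {ω | ∀ i, (N i t ω : ℝ) - N i s ω = n i} =
      ⋂ i, (fun ω ↦ (N i t ω : ℝ) - N i s ω) ⁻¹' {(n i : ℝ)} := by
    ext ω
    simp
  rw [h2, Measure.real, h1, ENNReal.toReal_prod, jumpMean, ← Finset.sum_neg_distrib,
    Real.exp_sum, ← Finset.prod_mul_distrib]
  refine Finset.prod_congr rfl fun i _ ↦ ?_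
  rw [← mul_div_assoc]
  exact (hN.poisson i).real_increment_eq hst
    (integral_rate_nonneg lam_nonneg i s.coe_nonneg hst) (n i)

/-- Only an inequality: different combinations of jumps may produce the same increment of S. -/
lemma real_increment_ge [IsProbabilityMeasure P] (hN : IsIndepPoissonFamily P I lam N)
    (lam_nonneg : ∀ (i : I) (t : ℝ), 0 ≤ t → 0 ≤ lam i t)
    (hsum : ∀ t, ∀ᵐ ω ∂P, S t ω = ∑ i : I, (i : ℝ) * (N i t ω : ℝ))
    {s t : ℝ≥0} (hst : s ≤ t) (n : I → ℕ) :
    Real.exp (-jumpMean lam s t) *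
        ∏ i, ((∫ x in (s : ℝ)..t, lam i x) ^ n i / (n i).factorial) ≤
      P.real {ω | S t ω - S s ω = ∑ i : I, (i : ℝ) * n i} := by
  rw [← hN.real_forall_increment_eq lam_nonneg hst]
  refine ENNReal.toReal_mono (measure_ne_top _ _) (measure_mono_ae ?_)
  filter_upwards [hsum s, hsum t] with ω h1 h2 h3
  change S t ω - S s ω = _
  rw [h1, h2, ← Finset.sum_sub_distrib]
  refine Finset.sum_congr rfl fun i _ ↦ ?_
  rw [← mul_sub, h3 i]

/-- The increment of `S` over a short time interval: up to an error of second order in the expected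
number of jumps, either `S` does not jump or it jumps once. -/
lemma abs_real_increment_sub_le [IsProbabilityMeasure P] (hI : (0 : ℝ) ∉ I)
    (hN : IsIndepPoissonFamily P I lam N)
    (lam_nonneg : ∀ (i : I) (t : ℝ), 0 ≤ t → 0 ≤ lam i t)
    (S_measurable : ∀ t, Measurable (S t))
    (hsum : ∀ t, ∀ᵐ ω ∂P, S t ω = ∑ i : I, (i : ℝ) * (N i t ω : ℝ))
    {s t : ℝ≥0} (hst : s ≤ t) :
    (∀ i : I, |P.real {ω | S t ω - S s ω = i} - ∫ x in (s : ℝ)..t, lam i x| ≤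
        2 * jumpMean lam s t ^ 2) ∧
      |P.real {ω | S t ω - S s ω = 0} - (1 - jumpMean lam s t)| ≤ 2 * jumpMean lam s t ^ 2 ∧
      ∀ j : ℝ, j ≠ 0 → j ∉ I → P.real {ω | S t ω - S s ω = j} ≤ jumpMean lam s t ^ 2 := by
  classical
  set m := jumpMean lam s t with hm
  set r : I → ℝ := fun i ↦ ∫ x in (s : ℝ)..t, lam i x with hr
  have hr0 (i : I) : 0 ≤ r i := integral_rate_nonneg lam_nonneg i s.coe_nonneg hst
  have hm0 : 0 ≤ m := jumpMean_nonneg lam_nonneg s.coe_nonneg hst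
  have hrm (i : I) : r i ≤ m := Finset.single_le_sum (fun i _ ↦ hr0 i) (Finset.mem_univ i)
  set p : ℝ → ℝ := fun x ↦ P.real {ω | S t ω - S s ω = x} with hp
  have hp0 (x : ℝ) : 0 ≤ p x := measureReal_nonneg
  have hzero : Real.exp (-m) ≤ p 0 := by
    have := hN.real_increment_ge lam_nonneg hsum hst 0
    simpa using this
  have hone (i : I) : Real.exp (-m) * r i ≤ p i := by
    have := hN.real_increment_ge lam_nonneg hsum hst (Pi.single i 1)
    have h1 : ∑ j : I, (j : ℝ) * ((Pi.single i 1 : I → ℕ) j : ℝ) = i := by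
      rw [Finset.sum_eq_single i (fun j _ hj ↦ by simp [hj]) (by simp)]
      simp
    have h2 : ∏ j : I, (r j ^ (Pi.single i 1 : I → ℕ) j /
        ((Pi.single i 1 : I → ℕ) j).factorial : ℝ) = r i := by
      rw [Finset.prod_eq_single i (fun j _ hj ↦ by simp [hj]) (by simp)]
      simp
    rwa [h1, h2] at this
  have htot (A : Finset ℝ) : ∑ x ∈ A, p x ≤ 1 := by
    have hX : Measurable fun ω ↦ S t ω - S s ω := (S_measurable t).sub (S_measurable s)
    have h1 := sum_measureReal_preimage_singleton (μ := P) A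
      (f := fun ω ↦ S t ω - S s ω) fun x _ ↦ hX (measurableSet_singleton x)
    calc ∑ x ∈ A, p x = P.real ((fun ω ↦ S t ω - S s ω) ⁻¹' ↑A) := h1
      _ ≤ 1 := measureReal_le_one
  have hsumI : ∑ x ∈ I, p x = ∑ i : I, p i := (Finset.sum_coe_sort I p).symm
  have hsr : ∑ i : I, r i = m := rfl
  have hexp := Real.add_one_le_exp (-m)
  have hexp1 : Real.exp (-m) ≤ 1 := Real.exp_le_one_iff.2 (by linarith)
  have hexp2 := exp_neg_le_one_sub_add_sq hm0
  have hlow : ∑ i : I, p i ≥ Real.exp (-m) * m := by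
    rw [← hsr, Finset.mul_sum]
    exact Finset.sum_le_sum fun i _ ↦ hone i
  -- Upper bounds come from total mass. The lower bounds on the values in I ∪ {0} already use
  -- exp(-m)(1 + m) ≥ 1 - m², so at most m² is left over for all excesses and all other values. No
  -- enumeration of coinciding sums of jumps is needed.
  have h01 : p 0 + ∑ i : I, p i ≤ 1 := by
    have := htot (insert 0 I)
    rwa [Finset.sum_insert hI, hsumI] at this
  refine ⟨fun i ↦ ?_, ?_, fun j hj hjI ↦ ?_⟩
  · have h1 : p i - Real.exp (-m) * r i ≤ ∑ j : I, (p j - Real.exp (-m) * r j) :=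
      Finset.single_le_sum (f := fun j : I ↦ p j - Real.exp (-m) * r j)
        (fun j _ ↦ sub_nonneg.2 (hone j)) (Finset.mem_univ i)
    rw [Finset.sum_sub_distrib, ← Finset.mul_sum, hsr] at h1
    have h2 := hone i
    have h3 := hrm i
    have h4 := hr0 i
    rw [abs_le]
    constructor
    · change _ ≤ p i - r i
      nlinarith
    · change p i - r i ≤ _
      nlinarith
  · rw [abs_le]
    constructor
    · change _ ≤ p 0 - _
      nlinarith
    · change p 0 - _ ≤ _
      nlinarith
  · have h1 := htot (insert j (insert 0 I))
    rw [Finset.sum_insert (by simp [hj, hjI]), Finset.sum_insert hI, hsumI] at h1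
    change p j ≤ _
    nlinarith

lemma real_ne_le [IsProbabilityMeasure P] (hN : IsIndepPoissonFamily P I lam N)
    (lam_nonneg : ∀ (i : I) (t : ℝ), 0 ≤ t → 0 ≤ lam i t)
    (S_measurable : ∀ t, Measurable (S t))
    (hsum : ∀ t, ∀ᵐ ω ∂P, S t ω = ∑ i : I, (i : ℝ) * (N i t ω : ℝ))
    {s t : ℝ≥0} (hst : s ≤ t) : P.real {ω | S t ω ≠ S s ω} ≤ jumpMean lam s t := by
  have h1 := hN.real_increment_ge lam_nonneg hsum hst 0
  have h2 : P.real {ω | S t ω ≠ S s ω} = 1 - P.real {ω | S t ω = S s ω} :=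
    probReal_compl_eq_one_sub (measurableSet_eq_fun (S_measurable t) (S_measurable s))
  have h3 := Real.add_one_le_exp (-jumpMean lam s t)
  simp only [Pi.zero_apply, pow_zero, Nat.factorial_zero, Nat.cast_one, div_one,
    Finset.prod_const_one, mul_one, Nat.cast_zero, mul_zero, Finset.sum_const_zero,
    sub_eq_zero] at h1
  linarith

lemma stochContinuous [IsProbabilityMeasure P] (hN : IsIndepPoissonFamily P I lam N)
    (lam_nonneg : ∀ (i : I) (t : ℝ), 0 ≤ t → 0 ≤ lam i t)
    (lam_integrable : ∀ (i : I) (t : ℝ), 0 ≤ t → IntegrableOn (lam i) (Set.Icc 0 t) volume)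
    (S_measurable : ∀ t, Measurable (S t))
    (hsum : ∀ t, ∀ᵐ ω ∂P, S t ω = ∑ i : I, (i : ℝ) * (N i t ω : ℝ)) :
    StochContinuous P S := by
  intro t
  rw [tendstoInMeasure_iff_measureReal_dist]
  intro ε hε
  have hT : (0 : ℝ) ≤ t + 1 := by positivity
  have hc := (continuousOn_jumpMean lam_integrable hT) t ⟨t.coe_nonneg, by linarith⟩
  have hto : Tendsto (fun u : ℝ≥0 ↦ (u : ℝ)) (𝓝 t) (𝓝[Set.Icc 0 ((t : ℝ) + 1)] t) := by
    refine tendsto_nhdsWithin_of_tendsto_nhds_of_eventually_within _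
      (NNReal.continuous_coe.tendsto t) ?_
    filter_upwards [Iio_mem_nhds (show t < t + 1 by simp)] with u hu
    exact ⟨u.coe_nonneg, by exact_mod_cast le_of_lt hu⟩
  have hlim : Tendsto (fun u : ℝ≥0 ↦ |jumpMean lam 0 u - jumpMean lam 0 t|) (𝓝 t) (𝓝 0) := by
    have := ((hc.tendsto.comp hto).sub_const (jumpMean lam 0 t)).abs
    simpa using this
  refine squeeze_zero (fun _ ↦ measureReal_nonneg) (fun u ↦ ?_) hlim
  have hsub : P.real {ω | ε ≤ dist (S u ω) (S t ω)} ≤ P.real {ω | S u ω ≠ S t ω} := by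
    refine measureReal_mono (fun ω hω h ↦ ?_) (measure_ne_top _ _)
    simp only [Set.mem_ofPred_eq] at hω
    rw [h, dist_self] at hω
    linarith
  refine hsub.trans ?_
  have hadd (a b : ℝ≥0) : jumpMean lam a b = jumpMean lam 0 b - jumpMean lam 0 a := by
    have := jumpMean_add lam_integrable le_rfl a.coe_nonneg b.coe_nonneg
    linarith
  rcases le_total t u with h | h
  · refine (hN.real_ne_le lam_nonneg S_measurable hsum h).trans ?_
    rw [hadd]
    exact le_abs_self _
  · have := hN.real_ne_le lam_nonneg S_measurable hsum h
    simp only [ne_comm (a := S t _)] at this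
    refine this.trans ?_
    rw [hadd, abs_sub_comm]
    exact le_abs_self _

lemma _root_.Skellam.HasRateAt.isLittleO
    (lam_integrable : ∀ (i : I) (t : ℝ), 0 ≤ t → IntegrableOn (lam i) (Set.Icc 0 t) volume)
    {i : I} {t : ℝ≥0} (h : HasRateAt (lam i) t) :
    (fun u : ℝ≥0 ↦ (∫ x in (t : ℝ)..(t + u : ℝ≥0), lam i x) - lam i t * u) =o[𝓝[>] 0]
      (fun u : ℝ≥0 ↦ (u : ℝ)) := by
  rw [HasRateAt, hasDerivWithinAt_iff_isLittleO] at h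
  have hto : Tendsto (fun u : ℝ≥0 ↦ (t + u : ℝ)) (𝓝[>] 0) (𝓝[Set.Ici (t : ℝ)] t) := by
    refine tendsto_nhdsWithin_of_tendsto_nhds_of_eventually_within _ ?_
      (Eventually.of_forall fun u ↦ by simp)
    have : Tendsto (fun u : ℝ≥0 ↦ (t + u : ℝ)) (𝓝 0) (𝓝 (t + (0 : ℝ≥0))) :=
      (by fun_prop : Continuous fun u : ℝ≥0 ↦ (t + u : ℝ)).tendsto 0
    simpa using this.mono_left nhdsWithin_le_nhds
  refine (h.comp_tendsto hto).congr (fun u ↦ ?_) (fun u ↦ by simp)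
  simp only [Function.comp_apply, cumRate, smul_eq_mul, NNReal.coe_add, add_sub_cancel_left]
  rw [intervalIntegral.integral_interval_sub_left
    (intervalIntegrable_rate lam_integrable i le_rfl (by positivity))
    (intervalIntegrable_rate lam_integrable i le_rfl t.coe_nonneg), mul_comm]

/-- The estimates for increments have errors quadratic in the mean, and the mean over [t, t + h] is
∑ λ_i(t) h + o(h) by the right derivatives; its square is o(h). -/
lemma infinitesimalJumpsAt [IsProbabilityMeasure P] (hI : (0 : ℝ) ∉ I)
    (hN : IsIndepPoissonFamily P I lam N)
    (lam_nonneg : ∀ (i : I) (t : ℝ), 0 ≤ t → 0 ≤ lam i t)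
    (lam_integrable : ∀ (i : I) (t : ℝ), 0 ≤ t → IntegrableOn (lam i) (Set.Icc 0 t) volume)
    (S_measurable : ∀ t, Measurable (S t)) (S_zero : ∀ᵐ ω ∂P, S 0 ω = 0)
    (hsum : ∀ t, ∀ᵐ ω ∂P, S t ω = ∑ i : I, (i : ℝ) * (N i t ω : ℝ))
    {t : ℝ≥0} (ht : ∀ i : I, HasRateAt (lam i) t) : InfinitesimalJumpsAt P I lam S t := by
  have hrate (i : I) := (ht i).isLittleO lam_integrable
  have hmean : (fun h : ℝ≥0 ↦ jumpMean lam t (t + h : ℝ≥0) - ∑ i : I, lam i t * h) =o[𝓝[>] 0]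
      (fun h : ℝ≥0 ↦ (h : ℝ)) := by
    simp only [jumpMean, ← Finset.sum_sub_distrib]
    exact IsLittleO.fun_sum fun i _ ↦ hrate i
  have hO : (fun h : ℝ≥0 ↦ jumpMean lam t (t + h : ℝ≥0)) =O[𝓝[>] 0] (fun h : ℝ≥0 ↦ (h : ℝ)) := by
    have h1 : (fun h : ℝ≥0 ↦ ∑ i : I, lam i t * (h : ℝ)) =O[𝓝[>] 0] (fun h : ℝ≥0 ↦ (h : ℝ)) :=
      IsBigO.fun_sum fun i _ ↦ (isBigO_refl _ _).const_mul_left _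
    simpa using hmean.isBigO.add h1
  have hid : Tendsto (fun h : ℝ≥0 ↦ (h : ℝ)) (𝓝[>] 0) (𝓝 0) := by
    have : Tendsto (fun h : ℝ≥0 ↦ (h : ℝ)) (𝓝 0) (𝓝 ((0 : ℝ≥0) : ℝ)) :=
      NNReal.continuous_coe.tendsto 0
    exact this.mono_left nhdsWithin_le_nhds
  have hsq : (fun h : ℝ≥0 ↦ 2 * jumpMean lam t (t + h : ℝ≥0) ^ 2) =o[𝓝[>] 0]
      (fun h : ℝ≥0 ↦ (h : ℝ)) := by
    have h1 := hO.mul_isLittleO (hO.trans_isLittleO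
      ((isLittleO_one_iff ℝ).2 hid))
    simpa [sq] using h1.const_mul_left 2
  have hest (h : ℝ≥0) := hN.abs_real_increment_sub_le hI lam_nonneg S_measurable hsum
    (le_self_add : t ≤ t + h)
  intro n hn
  simp only [transProb_eq_incProb S_measurable S_zero (hN.hasIndepIncrements hsum) hn]
  refine ⟨fun i ↦ ?_, ?_, fun j hj hjI ↦ ?_⟩
  · have h1 : (fun h : ℝ≥0 ↦ incProb P S t h i - ∫ x in (t : ℝ)..(t + h : ℝ≥0), lam i x)
        =o[𝓝[>] 0] (fun h : ℝ≥0 ↦ (h : ℝ)) :=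
      IsBigO.trans_isLittleO (IsBigO.of_bound 1 (Eventually.of_forall fun h ↦ by
        rw [one_mul]
        exact ((hest h).1 i).trans (le_abs_self _))) hsq
    refine (h1.add (hrate i)).congr_left fun h ↦ by ring
  · have h1 : (fun h : ℝ≥0 ↦ incProb P S t h 0 - (1 - jumpMean lam t (t + h : ℝ≥0)))
        =o[𝓝[>] 0] (fun h : ℝ≥0 ↦ (h : ℝ)) :=
      IsBigO.trans_isLittleO (IsBigO.of_bound 1 (Eventually.of_forall fun h ↦ by
        rw [one_mul]
        exact (hest h).2.1.trans (le_abs_self _))) hsq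
    refine (h1.sub hmean).congr_left fun h ↦ by ring
  · refine IsBigO.trans_isLittleO (IsBigO.of_bound 1 (Eventually.of_forall fun h ↦ ?_)) hsq
    rw [one_mul, Real.norm_of_nonneg (show 0 ≤ incProb P S t h j from measureReal_nonneg)]
    refine ((hest h).2.2 j hj hjI).trans (le_trans ?_ (le_abs_self _))
    nlinarith [sq_nonneg (jumpMean lam t (t + h : ℝ≥0))]

lemma integral_rpow_mul_increment (hN : IsIndepPoissonFamily P I lam N)
    (lam_nonneg : ∀ (i : I) (t : ℝ), 0 ≤ t → 0 ≤ lam i t) (i : I) {s t : ℝ≥0} (hst : s ≤ t)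
    {u : ℝ} (hu : 0 < u) :
    ∫ ω, u ^ ((i : ℝ) * ((N i t ω : ℝ) - N i s ω)) ∂P =
      Real.exp (-((∫ x in (s : ℝ)..t, lam i x) * (1 - u ^ (i : ℝ)))) := by
  have h0 := integral_rate_nonneg lam_nonneg i s.coe_nonneg hst
  have hlaw := (hN.poisson i).law_increments s t hst
  set m := ∫ x in (s : ℝ)..t, lam i x
  have hm0 : 0 ≤ m := h0
  have hmeas : Measurable fun x : ℝ ↦ u ^ ((i : ℝ) * x) :=
    (continuous_const.rpow (continuous_const.mul continuous_id) fun _ ↦ Or.inl hu.ne').measurable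
  calc ∫ ω, u ^ ((i : ℝ) * ((N i t ω : ℝ) - N i s ω)) ∂P
      = ∫ x, u ^ ((i : ℝ) * x) ∂(P.map fun ω ↦ (N i t ω : ℝ) - N i s ω) :=
        (integral_map hlaw.aemeasurable hmeas.aestronglyMeasurable).symm
    _ = ∫ n : ℕ, u ^ ((i : ℝ) * (n : ℝ)) ∂(poissonMeasure m.toNNReal) := by
        rw [hlaw.map_eq, integral_map measurable_from_top.aemeasurable
          hmeas.aestronglyMeasurable]
    _ = ∑' n : ℕ, Real.exp (-m) * ((m * u ^ (i : ℝ)) ^ n / n.factorial) := by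
        rw [integral_poissonMeasure, Real.coe_toNNReal m hm0]
        refine tsum_congr fun n ↦ ?_
        rw [Real.rpow_mul hu.le, Real.rpow_natCast, smul_eq_mul, mul_pow]
        ring
    _ = Real.exp (-m) * Real.exp (m * u ^ (i : ℝ)) := by
        rw [tsum_mul_left, Real.exp_eq_exp_ℝ, NormedSpace.exp_eq_tsum_div]
    _ = _ := by
        rw [← Real.exp_add]
        ring_nf

lemma integrable_rpow_and_integral_eq [IsProbabilityMeasure P] (hN : IsIndepPoissonFamily P I lam N)
    (lam_nonneg : ∀ (i : I) (t : ℝ), 0 ≤ t → 0 ≤ lam i t)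
    (hsum : ∀ t, ∀ᵐ ω ∂P, S t ω = ∑ i : I, (i : ℝ) * (N i t ω : ℝ))
    (t : ℝ≥0) {u : ℝ} (hu : 0 < u) :
    Integrable (fun ω ↦ u ^ S t ω) P ∧
      ∫ ω, u ^ S t ω ∂P = Real.exp (-∑ i : I, cumRate (lam i) t * (1 - u ^ (i : ℝ))) := by
  have hmeas (i : I) : Measurable fun x : ℝ ↦ u ^ ((i : ℝ) * x) :=
    (continuous_const.rpow (continuous_const.mul continuous_id) fun _ ↦ Or.inl hu.ne').measurable
  have heq : ∫ ω, u ^ S t ω ∂P =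
      Real.exp (-∑ i : I, cumRate (lam i) t * (1 - u ^ (i : ℝ))) := by
    calc ∫ ω, u ^ S t ω ∂P
        = ∫ ω, ∏ i : I, u ^ ((i : ℝ) * ((N i t ω : ℝ) - N i 0 ω)) ∂P := by
          refine integral_congr_ae ?_
          filter_upwards [hsum t, ae_all_iff.2 fun i ↦ (hN.poisson i).zero] with ω h1 h2
          rw [h1, Real.rpow_sum_of_pos hu]
          simp [h2]
      _ = ∏ i : I, ∫ ω, u ^ ((i : ℝ) * ((N i t ω : ℝ) - N i 0 ω)) ∂P :=
          (hN.iIndepFun_increment 0 t).integral_fun_prod_comp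
            (f := fun (i : I) x ↦ u ^ ((i : ℝ) * x))
            (fun i ↦ (hN.measurable_increment 0 t i).aemeasurable)
            fun i ↦ (hmeas i).aestronglyMeasurable
      _ = _ := by
          rw [← Finset.sum_neg_distrib, Real.exp_sum]
          refine Finset.prod_congr rfl fun i _ ↦ ?_
          rw [hN.integral_rpow_mul_increment lam_nonneg i (zero_le : 0 ≤ t) hu]
          rfl
  refine ⟨?_, heq⟩
  -- The integral of a non-integrable function is 0 by convention, while the computed value is
  -- positive; the computation of the integral thus proves integrability.
  by_contra hcon
  rw [integral_undef hcon] at heq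
  exact (Real.exp_pos _).ne heq

/-- Both sides are right-continuous almost surely, and they agree at the countably many dyadic times
outside one null set. -/
lemma ae_forall_eq (hN : IsIndepPoissonFamily P I lam N)
    (hsum : ∀ t, ∀ᵐ ω ∂P, S t ω = ∑ i : I, (i : ℝ) * (N i t ω : ℝ))
    (hS : ∀ᵐ ω ∂P, ∀ t : ℝ≥0, ContinuousWithinAt (fun s ↦ S s ω) (Set.Ici t) t) :
    ∀ᵐ ω ∂P, ∀ t, S t ω = ∑ i : I, (i : ℝ) * (N i t ω : ℝ) := by
  filter_upwards [hS, ae_all_iff.2 fun i ↦ (hN.poisson i).paths,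
    ae_forall_isDyadic fun t _ ↦ hsum t] with ω h1 h2 h3 t
  have hto : Tendsto (fun n ↦ nextDyadic n t) atTop (𝓝[≥] t) :=
    tendsto_nhdsWithin_of_tendsto_nhds_of_eventually_within _ (tendsto_nextDyadic t)
      (Eventually.of_forall fun n ↦ (lt_nextDyadic n t).le)
  have h4 := (h1 t).tendsto.comp hto
  have h5 : Tendsto (fun n ↦ ∑ i : I, (i : ℝ) * (N i (nextDyadic n t) ω : ℝ)) atTop
      (𝓝 (∑ i : I, (i : ℝ) * (N i t ω : ℝ))) := by
    refine tendsto_finsetSum _ fun i _ ↦ Tendsto.const_mul _ ?_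
    exact (continuous_of_discreteTopology.tendsto _).comp (((h2 i).2 t).tendsto.comp hto)
  refine tendsto_nhds_unique h4 (h5.congr fun n ↦ ?_)
  exact (h3 _ (isDyadic_nextDyadic n t)).symm

end IsIndepPoissonFamily

end Converse

end Skellam

/-! ### The theorem -/

theorem mainTheorem1 {Ω : Type*} [MeasurableSpace Ω] (P : Measure Ω) [IsProbabilityMeasure P]
    (I : Finset ℝ) (hI : (0 : ℝ) ∉ I) (lam : I → ℝ → ℝ)
    (lam_nonneg : ∀ (i : I) (t : ℝ), 0 ≤ t → 0 ≤ lam i t)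
    (lam_integrable : ∀ (i : I) (t : ℝ), 0 ≤ t → IntegrableOn (lam i) (Set.Icc 0 t) volume)
    (S : ℝ≥0 → Ω → ℝ) (S_measurable : ∀ t, Measurable (S t))
    (S_zero : ∀ᵐ ω ∂P, S 0 ω = 0) :
    -- the equivalence of the two descriptions
    ((∀ (i : I) (t : ℝ≥0), Skellam.HasRateAt (lam i) t) →
      (Skellam.IsInfinitesimalSkellam P I lam S ↔ Skellam.IsPoissonCombination P I lam S)) ∧
    -- from the first to the second, for all locally integrable rates
    (Skellam.IsInfinitesimalSkellam P I lam S → Skellam.IsPoissonCombination P I lam S) ∧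
    -- from the second to the first, for all locally integrable rates
    (Skellam.IsPoissonCombination P I lam S →
      HasIndepIncrements S P ∧ Skellam.StochContinuous P S ∧
      ∀ t : ℝ≥0, (∀ i : I, Skellam.HasRateAt (lam i) t) →
        Skellam.InfinitesimalJumpsAt P I lam S t) ∧
    -- for right-continuous paths, the representation holds for all times simultaneously
    ((∀ᵐ ω ∂P, ∀ t : ℝ≥0, ContinuousWithinAt (fun s ↦ S s ω) (Set.Ici t) t) →
      (Skellam.IsPoissonCombination P I lam S ↔
        Skellam.IsPathwisePoissonCombination P I lam S)) ∧
    -- the probability generating function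
    (Skellam.IsInfinitesimalSkellam P I lam S ∨ Skellam.IsPoissonCombination P I lam S →
      ∀ (t : ℝ≥0) (u : ℝ), 0 < u →
        Integrable (fun ω ↦ u ^ S t ω) P ∧
        ∫ ω, u ^ S t ω ∂P =
          Real.exp (-∑ i : I, Skellam.cumRate (lam i) t * (1 - u ^ (i : ℝ)))) := by
  have forward : Skellam.IsInfinitesimalSkellam P I lam S →
      Skellam.IsPoissonCombination P I lam S := fun h ↦
    h.isPoissonCombination hI lam_nonneg lam_integrable S_measurable S_zero
  have backward : Skellam.IsPoissonCombination P I lam S →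
      HasIndepIncrements S P ∧ Skellam.StochContinuous P S ∧
      ∀ t : ℝ≥0, (∀ i : I, Skellam.HasRateAt (lam i) t) →
        Skellam.InfinitesimalJumpsAt P I lam S t := by
    rintro ⟨N, hN, hsum⟩
    exact ⟨hN.hasIndepIncrements hsum,
      hN.stochContinuous lam_nonneg lam_integrable S_measurable hsum, fun t ht ↦
      hN.infinitesimalJumpsAt hI lam_nonneg lam_integrable S_measurable S_zero hsum ht⟩
  refine ⟨fun hrate ↦ ⟨forward, fun h ↦ ?_⟩, forward, backward, fun hpath ↦ ⟨?_, ?_⟩, ?_⟩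
  · obtain ⟨h1, h2, h3⟩ := backward h
    exact ⟨h1, h2, fun t ↦ h3 t fun i ↦ hrate i t⟩
  · rintro ⟨N, hN, hsum⟩
    exact ⟨N, hN, hN.ae_forall_eq hsum hpath⟩
  · rintro ⟨N, hN, hsum⟩
    exact ⟨N, hN, fun t ↦ hsum.mono fun ω h ↦ h t⟩
  · intro h t u hu
    obtain ⟨N, hN, hsum⟩ := h.elim forward id
    exact hN.integrable_rpow_and_integral_eq lam_nonneg hsum t hu
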